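/- Let $(\mathcal X,\mathcal F)$ be a measurable space and let $Y=(Y_n)_{n\ge 0}$ be a time-homogeneous Markov chain on it with probability transition kernel $P$. Let $\mathbb P_x$ be the law of the chain started at $x$, let $\mathbb P_\nu=\int \mathbb P_x(\cdot)\,\nu(dx)$ for an arbitrary measure $\nu$, and let $\mathbb E_x,\mathbb E_\nu$ be the corresponding integrals. Write $\tau_B=\inf\{n\ge 1: Y_n\in B\}$, with $\inf\varnothing=\infty$. A measure $\mu$ is *invariant* if $\int P(x,\cdot)\,\mu(dx)=\mu$. An invariant measure $\mu$ is *recurrent* if for every $B\in\mathcal F$ with $\mu(B)<\infty$ one has $\mathbb P_x(\tau_B<\infty)=1$ for $\mu$-a.e. $x\in B$; it is *ergodic* if the shift on the space of sequences is ergodic under $\mathbb P_\mu(Y\in\cdot)$; it is *irreducible* if for every $B\in\mathcal F$ such that $P(x,B)=\mathbf 1_B(x)$ for $\mu$-a.e. $x$, one has $\mu(B)=0$ or $\mu(B^c)=0$. The same notions apply to every Markov chain. For $A\in\mathcal F$ let $T=T_1^{\rangle A}=\inf\{k\ge 1: Y_{k-1}\in A^c,\ Y_k\in A\}$, and let $\dagger\notin\mathcal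 X$ be a cemetery state. Put $Y_1^{\rangle A}=Y_T$ and $Y_1^{A^c\rangle}=Y_{T-1}$ if $T<\infty$, and let both be $\dagger$ if $T=\infty$. Let $N_A$ be the set of $x$ such that $\mathbb P_x$-a.s. $Y$ visits both $A$ and $A^c$ infinitely often, and let $A^c_{ex}=\{x\in A^c:P(x,A)>0\}$. The *entrance chain* $Y^{\rangle A}$ is the Markov chain on $A\cup\{\dagger\}$ with transition probabilities $\mathbb P_x(Y_1^{\rangle A}\in\cdot)$ for $x\in A$. The *exit chain* $Y^{A^c\rangle}$ is the Markov chain on $A^c\cup\{\dagger\}$ with transition probabilities $\int_A\mathbb P_z(Y_1^{A^c\rangle}\in\cdot)\,\mathbb P_x(Y_1\in dz\mid Y_1\in A)$ for $x\in A^c_{ex}$, which moves to $\dagger$ from every $x\in A^c\setminus A^c_{ex}$. In both chains $\dagger$ is absorbing. A measure $\nu$ on $A$ (respectively on $A^c$) is regarded as a measure on $A\cup\{\dagger\}$ (respectively on $A^c\cup\{\dagger\}$) that does not charge $\dagger$. It is *proper* for $Y^{\rangle A}$ if $\nu(A\setminus N_A)=0$ (respectively, proper for $Y^{A^c\rangle}$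 if $\nu(A^c\setminus(A^c_{ex}\cap N_A))=0$). **Theorem.** Let $\mu$ be a $\sigma$-finite recurrent invariant measure of $Y$, and let $A\in\mathcal F$ be a set such that $\mathbb P_\mu(Y_0\in A^c,\,Y_1\in A)>0$. Then the measures $$\mu_A^{entr}=\int_{A^c}\mathbb P_x(Y_1\in\cdot)\,\mu(dx)\ \text{ on } A,\qquad \mu_{A^c}^{exit}(dx)=\mathbb P_x(Y_1\in A)\,\mu(dx)\ \text{ on } A^c$$ are proper, recurrent and invariant for the entrance chain $Y^{\rangle A}$ and the exit chain $Y^{A^c\rangle}$, respectively. If $\mu$ is irreducible, then both measures are ergodic for these chains, and $$\mu=\mathbb E_{\mu_A^{entr}}\Big[\sum_{k=0}^{T_1^{\rangle A}-1}\mathbf 1(Y_k\in\cdot)\Big].\qquad (*)$$ Moreover, $(*)$ also holds (without assuming irreducibility) whenever $\mathbb P_{\mu_A}(\tau_{A^c}=\infty)=0$ and $\mathbb P_{\mu_{A^c}}(\tau_A=\infty)=0$, where $\mu_A,\mu_{A^c}$ are the restrictions of $\mu$ to $A$ and $A^c$. -/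

import Mathlib

open MeasureTheory ProbabilityTheory Filter
open scoped ENNReal

noncomputable section

namespace MarkovInducing

/-! ### Time-homogeneous Markov chains with a given transition kernel -/

section Chain

variable {X : Type*} [MeasurableSpace X]

/-- The transition kernel `P` seen as a kernel from histories `(y₀, …, yₙ)` to the next state:
only the last state of the history matters. -/
def stepKernel (P : Kernel X X) (n : ℕ) : Kernel ((i : Finset.Iic n) → X) X :=
  P.comap (fun h => h ⟨n, Finset.mem_Iic.2 le_rfl⟩) (measurable_pi_apply _)

instance (P : Kernel X X) [IsMarkovKernel P] (n : ℕ) : IsMarkovKernel (stepKernel P n) := by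
  unfold stepKernel; infer_instance

/-- `law P x` is the law `ℙ_x(Y ∈ ·)` on the space of sequences of the Markov chain `Y` with
transition kernel `P` started at `x` (given by the Ionescu-Tulcea theorem). -/
def law (P : Kernel X X) [IsMarkovKernel P] : Kernel X (ℕ → X) :=
  (Kernel.traj (X := fun _ => X) (stepKernel P) 0).comap (fun x _ => x)
    (measurable_pi_lambda _ fun _ => measurable_id)

instance (P : Kernel X X) [IsMarkovKernel P] : IsMarkovKernel (law P) := by
  unfold law; infer_instance

/-- `ℙ_ν(Y ∈ ·) = ∫ ℙ_x(Y ∈ ·) ν(dx)`, for an arbitrary (possibly infinite) measure `ν`. -/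
def lawFrom (P : Kernel X X) [IsMarkovKernel P] (ν : Measure X) : Measure (ℕ → X) :=
  ν.bind (law P)

/-- The one-sided shift on sequences. -/
def shift (y : ℕ → X) : ℕ → X := fun n => y (n + 1)

/-- The first hitting time of `B` at a positive time, `inf {n ≥ 1 : yₙ ∈ B}`, with `inf ∅ = ∞`. -/
def hitTime (B : Set X) (y : ℕ → X) : ℕ∞ :=
  ⨅ n ∈ {n : ℕ | 1 ≤ n ∧ y n ∈ B}, (n : ℕ∞)

/-- A recurrent invariant measure of the chain with transition kernel `P`: from almost every point
of any set of finite measure the chain returns to the set almost surely. -/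
def IsRecurrent (P : Kernel X X) [IsMarkovKernel P] (μ : Measure X) : Prop :=
  P.Invariant μ ∧ ∀ B : Set X, MeasurableSet B → μ B < ∞ →
    ∀ᵐ x ∂μ, x ∈ B → law P x {y | hitTime B y < ⊤} = 1

/-- An ergodic invariant measure: the shift is measure preserving and ergodic under the law of the
chain started under `μ`. -/
def IsErgodic (P : Kernel X X) [IsMarkovKernel P] (μ : Measure X) : Prop :=
  P.Invariant μ ∧ Ergodic shift (lawFrom P μ)

/-- Irreducibility of an invariant measure: every invariant set of the chain is trivial. -/
def IsIrreducibleMeasure (P : Kernel X X) (μ : Measure X) : Prop :=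
  P.Invariant μ ∧ ∀ B : Set X, MeasurableSet B →
    (∀ᵐ x ∂μ, P x B = B.indicator 1 x) → μ B = 0 ∨ μ Bᶜ = 0

/-- The set of starting points from which the chain almost surely visits both `A` and `Aᶜ`
infinitely often. -/
def crossingSet (P : Kernel X X) [IsMarkovKernel P] (A : Set X) : Set X :=
  {x | law P x {y | (∃ᶠ k in atTop, y k ∈ A) ∧ (∃ᶠ k in atTop, y k ∈ Aᶜ)} = 1}

/-- The exit set of `B`: the points of `B` from which the chain can leave `B` in one step. -/
def exitSet (P : Kernel X X) (B : Set X) : Set X :=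
  {x | x ∈ B ∧ 0 < P x Bᶜ}

end Chain

/-! ### Adding the cemetery state: `Option S` is `S ∪ {†}`, with `† = none` -/

/-- `C` is measurable in `S ∪ {†}` if and only if `C ∩ S` is measurable in `S`. -/
instance instMeasurableSpaceOption {S : Type*} [m : MeasurableSpace S] :
    MeasurableSpace (Option S) :=
  m.map some

section Cemetery

variable {S : Type*} [MeasurableSpace S]

lemma measurable_some : Measurable (some : S → Option S) := fun _ h => h

/-- The measure `ν` on `S` seen as a measure on `S ∪ {†}` that does not charge `†`. -/
def extendMeasure (ν : Measure S) : Measure (Option S) := ν.map some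

/-- The kernel on `S ∪ {†}` that extends `κ`, with `†` as an absorbing state. -/
def absorbing (κ : Kernel S (Option S)) : Kernel (Option S) (Option S) where
  toFun := fun o => o.elim (Measure.dirac none) (fun x => κ x)
  measurable' := fun _ hs => κ.measurable hs

instance (κ : Kernel S (Option S)) [IsMarkovKernel κ] : IsMarkovKernel (absorbing κ) := by
  refine ⟨fun o => ?_⟩
  cases o with
  | none => exact Measure.dirac.isProbabilityMeasure
  | some x => exact IsMarkovKernel.isProbabilityMeasure (κ := κ) x

end Cemetery

/-! ### Entrance into `A` from `Aᶜ` -/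

section Entrance

variable {X : Type*}

/-- The sequence `y` enters `A` from `Aᶜ` at time `k`. -/
def EntersAt (A : Set X) (y : ℕ → X) (k : ℕ) : Prop :=
  1 ≤ k ∧ y (k - 1) ∈ Aᶜ ∧ y k ∈ A

/-- The first entrance time of `y` to `A` from `Aᶜ`, with `inf ∅ = ∞`. -/
def entranceTime (A : Set X) (y : ℕ → X) : ℕ∞ :=
  ⨅ k ∈ {k : ℕ | EntersAt A y k}, (k : ℕ∞)

open Classical in
/-- The position of `y` at its first entrance time to `A` from `Aᶜ`; it is `†` if that time
is infinite. -/
def entrancePos (A : Set X) (y : ℕ → X) : Option A :=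
  if h : ∃ k, EntersAt A y k then some ⟨y (Nat.find h), (Nat.find_spec h).2.2⟩ else none

open Classical in
/-- The position of `y` just before its first entrance time to `A` from `Aᶜ`; it is `†` if that
time is infinite. -/
def exitPos (A : Set X) (y : ℕ → X) : Option (Aᶜ : Set X) :=
  if h : ∃ k, EntersAt A y k then some ⟨y (Nat.find h - 1), (Nat.find_spec h).2.1⟩ else none

variable [MeasurableSpace X] {A : Set X}

lemma measurableSet_entersAt (hA : MeasurableSet A) (k : ℕ) :
    MeasurableSet {y : ℕ → X | EntersAt A y k} := by
  have h1 : MeasurableSet {y : ℕ → X | y (k - 1) ∈ Aᶜ} := measurable_pi_apply (k - 1) hA.compl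
  have h2 : MeasurableSet {y : ℕ → X | y k ∈ A} := measurable_pi_apply k hA
  exact (MeasurableSet.const (1 ≤ k)).inter (h1.inter h2)

open Classical in
/-- A position read off at the first entrance time is a measurable function of the sequence. -/
lemma measurable_pos (hA : MeasurableSet A) {B : Set X} (hB : MeasurableSet B) (g : ℕ → ℕ)
    (hg : ∀ (y : ℕ → X) (h : ∃ k, EntersAt A y k), y (g (Nat.find h)) ∈ B) :
    Measurable (fun y : ℕ → X => if h : ∃ k, EntersAt A y k then
      some (⟨y (g (Nat.find h)), hg y h⟩ : B) else none) := by
  intro C hC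
  have hC' : MeasurableSet (Subtype.val '' ((some : B → Option B) ⁻¹' C)) :=
    hB.subtype_image hC
  have key : (fun y : ℕ → X => if h : ∃ k, EntersAt A y k then
      some (⟨y (g (Nat.find h)), hg y h⟩ : B) else none) ⁻¹' C =
      (⋃ k, ({y | EntersAt A y k} ∩ (⋂ j ∈ {j : ℕ | j < k}, {y | EntersAt A y j}ᶜ) ∩
        {y | y (g k) ∈ Subtype.val '' ((some : B → Option B) ⁻¹' C)})) ∪
      ({_y : ℕ → X | (none : Option B) ∈ C} ∩ ⋂ k, {y | EntersAt A y k}ᶜ) := by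
    ext y
    by_cases h : ∃ k, EntersAt A y k
    · have hr : y ∉ ({_y : ℕ → X | (none : Option B) ∈ C} ∩ ⋂ k, {y | EntersAt A y k}ᶜ) := by
        rintro ⟨-, h2⟩
        obtain ⟨k, hk⟩ := h
        exact (Set.mem_iInter.1 h2 k) hk
      simp only [Set.mem_union, hr, or_false, Set.mem_preimage, dif_pos h, Set.mem_iUnion]
      constructor
      · intro hy
        refine ⟨Nat.find h, ⟨Nat.find_spec h, ?_⟩, ⟨⟨_, hg y h⟩, hy, rfl⟩⟩
        simp only [Set.mem_iInter]
        exact fun j hj => Nat.find_min h hj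
      · rintro ⟨k, ⟨hk, hmin⟩, ⟨b, hb, hby⟩⟩
        simp only [Set.mem_iInter] at hmin
        have hk' : Nat.find h = k := (Nat.find_eq_iff h).2 ⟨hk, fun j hj => hmin j hj⟩
        have : (⟨y (g (Nat.find h)), hg y h⟩ : B) = b := Subtype.ext (by
          change y (g (Nat.find h)) = (b : X)
          rw [hk', hby])
        rw [this]; exact hb
    · have hl : y ∉ ⋃ k, ({y | EntersAt A y k} ∩ (⋂ j ∈ {j : ℕ | j < k}, {y | EntersAt A y j}ᶜ) ∩
        {y | y (g k) ∈ Subtype.val '' ((some : B → Option B) ⁻¹' C)}) := by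
        intro hy
        obtain ⟨k, hk⟩ := Set.mem_iUnion.1 hy
        exact h ⟨k, hk.1.1⟩
      simp only [Set.mem_union, hl, false_or, Set.mem_preimage, dif_neg h]
      constructor
      · exact fun hy => ⟨hy, Set.mem_iInter.2 fun k hk => h ⟨k, hk⟩⟩
      · exact fun hy => hy.1
  rw [key]
  refine (MeasurableSet.iUnion fun k => ?_).union ((MeasurableSet.const _).inter
    (MeasurableSet.iInter fun k => (measurableSet_entersAt hA k).compl))
  exact ((measurableSet_entersAt hA k).inter (MeasurableSet.biInter (Set.to_countable _)
    fun j _ => (measurableSet_entersAt hA j).compl)).inter (measurable_pi_apply (g k) hC')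

open Classical in
lemma measurable_entrancePos (hA : MeasurableSet A) : Measurable (entrancePos A) :=
  measurable_pos hA hA id fun _ h => (Nat.find_spec h).2.2

open Classical in
lemma measurable_exitPos (hA : MeasurableSet A) : Measurable (exitPos A) :=
  measurable_pos hA hA.compl (fun k => k - 1) fun _ h => (Nat.find_spec h).2.1

/-! ### The entrance chain and the exit chain -/

variable (P : Kernel X X)

lemma measurableSet_exitSet (hA : MeasurableSet A) : MeasurableSet (exitSet P Aᶜ) :=
  hA.compl.inter (measurableSet_lt measurable_const (P.measurable_coe hA.compl.compl))

variable [IsMarkovKernel P]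

/-- The transition kernel on `A ∪ {†}` of the entrance chain: from `x ∈ A` it is the
law under `ℙ_x` of the position at the first entrance time to `A` from `Aᶜ`. -/
def entranceKernel (_hA : MeasurableSet A) : Kernel (Option A) (Option A) :=
  absorbing (((law P).map (entrancePos A)).comap Subtype.val measurable_subtype_coe)

instance (hA : MeasurableSet A) : IsMarkovKernel (entranceKernel P hA) := by
  have := Kernel.IsMarkovKernel.map (law P) (measurable_entrancePos hA)
  unfold entranceKernel; infer_instance

open Classical in
/-- The transition law of the exit chain from `x ∈ Aᶜ`: if `x` lies in the exit set of `Aᶜ`, it is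
`∫_A ℙ_z(Y_{T - 1} ∈ ·) ℙ_x(Y₁ ∈ dz | Y₁ ∈ A)`, where `T` is the first entrance time to `A` from
`Aᶜ`; otherwise the chain is sent to `†`. -/
def exitStep (A : Set X) (x : X) : Measure (Option (Aᶜ : Set X)) :=
  if x ∈ exitSet P Aᶜ then
    (ProbabilityTheory.cond (P x) A).bind ((law P).map (exitPos A))
  else Measure.dirac none

lemma measurable_exitStep (hA : MeasurableSet A) : Measurable (exitStep P A) := by
  classical
  unfold exitStep
  refine Measurable.ite (measurableSet_exitSet P hA) ?_ measurable_const
  refine Measure.measurable_of_measurable_coe _ fun s hs => ?_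
  have : (fun x => (ProbabilityTheory.cond (P x) A).bind ((law P).map (exitPos A)) s) =
      fun x => (P x A)⁻¹ * ∫⁻ z in A, (law P).map (exitPos A) z s ∂(P x) := by
    ext x
    rw [Measure.bind_apply hs (Kernel.aemeasurable _), ProbabilityTheory.cond,
      lintegral_smul_measure, smul_eq_mul]
  rw [this]
  refine (P.measurable_coe hA).inv.mul ?_
  exact (Kernel.measurable_coe _ hs).setLIntegral_kernel hA

lemma isProbabilityMeasure_exitStep (hA : MeasurableSet A) (x : X) :
    IsProbabilityMeasure (exitStep P A x) := by
  unfold exitStep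
  split_ifs with h
  · have h0 : P x A ≠ 0 := by
      have := h.2
      rw [compl_compl] at this
      exact this.ne'
    have := ProbabilityTheory.cond_isProbabilityMeasure h0
    have := Kernel.IsMarkovKernel.map (law P) (measurable_exitPos hA)
    infer_instance
  · infer_instance

/-- The transition kernel on `Aᶜ ∪ {†}` of the exit chain. -/
def exitKernel (hA : MeasurableSet A) :
    Kernel (Option (Aᶜ : Set X)) (Option (Aᶜ : Set X)) :=
  absorbing ⟨fun x : (Aᶜ : Set X) => exitStep P A x,
    (measurable_exitStep P hA).comp measurable_subtype_coe⟩

instance (hA : MeasurableSet A) : IsMarkovKernel (exitKernel P hA) := by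
  unfold exitKernel
  have : IsMarkovKernel (⟨fun x : (Aᶜ : Set X) => exitStep P A x,
      (measurable_exitStep P hA).comp measurable_subtype_coe⟩ :
      Kernel (Aᶜ : Set X) (Option (Aᶜ : Set X))) :=
    ⟨fun x => isProbabilityMeasure_exitStep P hA x⟩
  infer_instance

/-- A measure on `A` is proper for the entrance chain if it does not charge the complement of the
set of points from which `Y` a.s. visits both `A` and `Aᶜ` infinitely often. -/
def IsProperEntrance (ν : Measure A) : Prop :=
  ν {x | (x : X) ∉ crossingSet P A} = 0

/-- A measure on `Aᶜ` is proper for the exit chain if it is carried by the points of the exit set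
of `Aᶜ` from which `Y` a.s. visits both `A` and `Aᶜ` infinitely often. -/
def IsProperExit (ν : Measure (Aᶜ : Set X)) : Prop :=
  ν {x | (x : X) ∉ exitSet P Aᶜ ∩ crossingSet P A} = 0

/-- The measure `∫_{Aᶜ} ℙ_x(Y₁ ∈ ·) μ(dx)` on `A`. -/
def entranceMeasure (A : Set X) (μ : Measure X) : Measure A :=
  ((μ.restrict Aᶜ).bind P).comap Subtype.val

/-- The measure `ℙ_x(Y₁ ∈ A) μ(dx)` on `Aᶜ`. -/
def exitMeasure (A : Set X) (μ : Measure X) : Measure (Aᶜ : Set X) :=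
  (μ.withDensity fun x => P x A).comap Subtype.val

/-- Kac's formula for the first entrance time `T` to `A` from `Aᶜ`: for every measurable `B`,
`μ(B)` is the integral against the entrance measure of the expected number of visits to `B`
at the times `0 ≤ k < T`. -/
def KacFormula (A : Set X) (μ : Measure X) : Prop :=
  ∀ B : Set X, MeasurableSet B →
    μ B = ∫⁻ a : A, ∫⁻ y, ∑' k : {k : ℕ // (k : ℕ∞) < entranceTime A y}, B.indicator 1 (y k)
      ∂(law P (a : X)) ∂(entranceMeasure P A μ)

/-- The chain started under `μ` on `A` a.s. reaches `Aᶜ`, and the chain started under `μ` on `Aᶜ`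
a.s. reaches `A`. -/
def CrossesBothWays (A : Set X) (μ : Measure X) : Prop :=
  lawFrom P (μ.restrict A) {y | hitTime Aᶜ y = ⊤} = 0 ∧
    lawFrom P (μ.restrict Aᶜ) {y | hitTime A y = ⊤} = 0

end Entrance

end MarkovInducing

end

open MarkovInducing

/-! Split the transition kernel as `P = P₀ + J`, where `J` (`enterKernel`) keeps the jumps from `Aᶜ`
to `A` and `P₀` (`stayKernel`) all other steps. Let `G = ∑ₖ P₀ᵏ` (`green`). The kernel `J` factors
as `Ψ ∘ₖ Φ` through a state space `S`: for the entrance chain, `Φ` records the point of `A` where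
the jump lands and `Ψ` is the inclusion; for the exit chain, `Φ` records the point of `Aᶜ` where the
jump starts and `Ψ` is the step conditioned on landing in `A`. In both cases a step `Q` of the new
chain, on functions vanishing at `†`, is `Ψ G Φ`, and the measure in question is `μΦ`. One argument,
organised by `IsInduced`, serves both chains.

Excessivity: invariance of `μ` gives `μ P₀ⁿφ = μ J P₀ⁿφ + μ P₀ⁿ⁺¹φ`, so by telescoping `μ J G φ ≤ μ
φ` (`lintegral_kop_green_le`), and hence `(μΦ)Q ≤ μΦ`.

Recurrence: if `f ≤ 1` is superharmonic for `Q`, then `g = G Φ f` is superharmonic for `P`. Under a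
recurrent measure such a `g` is harmonic almost everywhere (`IsRecurrent.kop_eq_of_le`), which
forces `Q f = f` almost everywhere for `μΦ`. With `f` the probability of ever visiting `B`, this
says that points of `B` return to `B`. An excessive measure with this return property is invariant
(`isRecurrent_of_excessive`).

Ergodicity: if `f` is the indicator of a `Q`-invariant set, `g` is harmonic, thus constant along the
chain and, by irreducibility of `μ`, equal to a constant; so is `f = Ψ g`. Irreducibility passes to
ergodicity of the shift by `IsIrreducibleMeasure.isErgodic`.

Kac's formula is `μ J G 1_B = μ B`: no mass may be lost in the telescoping, that is, `μ P₀ⁿ1_B → 0`.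
Invariance of `μΦ` gives this limit for the marks of sets of finite measure, and their potentials
dominate indicators of sets exhausting the space as soon as almost every path makes an entrance. -/

noncomputable section

namespace MarkovInducing

/-! ### One-step analysis of the path law -/

section OneStep

variable {X : Type*}

/-- The sequence `y` preceded by `x`. -/
def prepend (x : X) (y : ℕ → X) : ℕ → X
  | 0 => x
  | n + 1 => y n

@[simp] lemma prepend_zero (x : X) (y : ℕ → X) : prepend x y 0 = x := rfl

@[simp] lemma prepend_succ (x : X) (y : ℕ → X) (n : ℕ) : prepend x y (n + 1) = y n := rfl

variable [MeasurableSpace X]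

@[fun_prop]
lemma measurable_coord (n : ℕ) : Measurable fun y : ℕ → X => y n := measurable_pi_apply n

@[fun_prop]
lemma measurable_prepend (x : X) : Measurable (prepend x) :=
  measurable_pi_lambda _ fun n => by
    cases n
    · exact measurable_const
    · exact measurable_pi_apply _

@[fun_prop]
lemma measurable_shift : Measurable (shift : (ℕ → X) → ℕ → X) :=
  measurable_pi_lambda _ fun n => measurable_pi_apply (n + 1)

variable (P : Kernel X X) [IsMarkovKernel P]

lemma law_eq_traj (x : X) : law P x = Kernel.traj (X := fun _ => X) (stepKernel P) 0 (fun _ => x) :=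
  rfl

/-- The starting point is `x`, as far as measurable functions can see. -/
lemma lintegral_law_zero (x : X) {F : X → (ℕ → X) → ℝ≥0∞}
    (hF : Measurable (Function.uncurry F)) :
    ∫⁻ y, F (y 0) y ∂law P x = ∫⁻ y, F x y ∂law P x := by
  -- `Kernel.lintegral_traj` overwrites the coordinate at time 0 by the initial state, after which
  -- both integrands coincide. Singletons need not be measurable, so this replaces the event `y 0 =
  -- x`.
  rw [law_eq_traj, Kernel.lintegral_traj (X := fun _ => X) (f := fun y => F (y 0) y) _
    (hF.comp (f := fun y : ℕ → X => (y 0, y)) ((measurable_coord 0).prodMk measurable_id)),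
    Kernel.lintegral_traj (X := fun _ => X) (f := fun y => F x y) _
    (hF.comp (f := fun y : ℕ → X => (x, y)) (measurable_const.prodMk measurable_id))]
  rfl

lemma ae_law_zero {x : X} {p : X → Prop} (hp : MeasurableSet {x | p x}) :
    (∀ᵐ y ∂law P x, p (y 0)) ↔ p x := by
  have hm : Measurable ({x | p x}ᶜ.indicator (1 : X → ℝ≥0∞)) := measurable_one.indicator hp.compl
  have h := lintegral_law_zero P x (F := fun a _ => {x | p x}ᶜ.indicator 1 a)
    (hm.comp measurable_fst)
  rw [lintegral_const, measure_univ, mul_one] at h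
  have h2 : (∀ᵐ y ∂law P x, p (y 0)) ↔
      ∫⁻ y, {x | p x}ᶜ.indicator (1 : X → ℝ≥0∞) (y 0) ∂law P x = 0 := by
    rw [lintegral_eq_zero_iff (f := fun y : ℕ → X => {x | p x}ᶜ.indicator 1 (y 0))
      (hm.comp (measurable_coord 0))]
    refine eventually_congr (Eventually.of_forall fun y => ?_)
    by_cases hy : p (y 0) <;> simp [hy]
  rw [h2, h]
  by_cases hx : p x <;> simp [hx]

/-- Conditioning on the last step. -/
lemma lintegral_law_mul_last (x : X) (n : ℕ) {F : ((i : Finset.Iic n) → X) → ℝ≥0∞}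
    (hF : Measurable F) {g : X → ℝ≥0∞} (hg : Measurable g) :
    ∫⁻ y, F (Preorder.frestrictLe n y) * g (y (n + 1)) ∂law P x =
      ∫⁻ y, F (Preorder.frestrictLe n y) * ∫⁻ z, g z ∂P (y n) ∂law P x := by
  have h := Kernel.partialTraj_compProd_eq_map_traj (X := fun _ => X) (κ := stepKernel P)
    (a := 0) (b := n) (Nat.zero_le n) (x₀ := fun _ => x)
  have hm : Measurable (fun q : ((i : Finset.Iic n) → X) × X => F q.1 * g q.2) := by fun_prop
  have h1 := congrArg (fun ρ => ∫⁻ q, F q.1 * g q.2 ∂ρ) h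
  beta_reduce at h1
  rw [lintegral_map hm (by fun_prop), Measure.lintegral_compProd hm,
    ← Kernel.traj_map_frestrictLe_apply, lintegral_map _ (by fun_prop)] at h1
  · rw [law_eq_traj, ← h1]
    refine lintegral_congr fun y => ?_
    exact lintegral_const_mul (F (Preorder.frestrictLe n y)) hg
  · exact Measurable.lintegral_kernel_prod_right hm

/-- The trajectory is built by appending last steps, while the Markov property needs the first step.
Averaging the last coordinate folds it into the factor before; the induction hypothesis splits off
the first step of the shorter product, and the last coordinate is then restored. -/
lemma lintegral_prod_succ (x : X) (n : ℕ) {F : ℕ → X → ℝ≥0∞} (hF : ∀ i, Measurable (F i)) :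
    ∫⁻ y, ∏ i ∈ Finset.range (n + 1), F i (y i) ∂law P x =
      F 0 x * ∫⁻ z, ∫⁻ y, ∏ i ∈ Finset.range n, F (i + 1) (y i) ∂law P z ∂P x := by
  have last : ∀ (w : X) (n : ℕ) (F : ℕ → X → ℝ≥0∞), (∀ i, Measurable (F i)) →
      ∫⁻ y, ∏ i ∈ Finset.range (n + 2), F i (y i) ∂law P w =
      ∫⁻ y, (∏ i ∈ Finset.range n, F i (y i)) * (F n (y n) * ∫⁻ z, F (n + 1) z ∂P (y n))
        ∂law P w := by
    intro w n F hF
    have := lintegral_law_mul_last P w n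
      (F := fun h => ∏ i : Finset.Iic n, F i (h i)) (by fun_prop) (hF (n + 1))
    have e : ∀ y : ℕ → X, ∏ i : Finset.Iic n, F i (y i) =
        ∏ i ∈ Finset.range (n + 1), F i (y i) := by
      intro y
      rw [Finset.prod_coe_sort (Finset.Iic n) (fun i => F i (y i))]
      congr 1; ext i; simp
    simp only [Preorder.frestrictLe_apply, e] at this
    simp only [Finset.prod_range_succ _ (n + 1)]
    rw [this]
    simp only [Finset.prod_range_succ, mul_assoc]
  have hz : ∀ (w : X) (G : X → ℝ≥0∞), Measurable G → ∫⁻ y, G (y 0) ∂law P w = G w := by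
    intro w G hG
    rw [lintegral_law_zero P w (F := fun a _ => G a) (hG.comp measurable_fst)]
    simp
  induction n generalizing F with
  | zero => simp [hz x _ (hF 0)]
  | succ n ih =>
    rw [last x n F hF]
    have hk : Measurable fun w => F n w * ∫⁻ z, F (n + 1) z ∂P w :=
      (hF n).mul (hF (n + 1)).lintegral_kernel
    cases n with
    | zero =>
      simp only [Finset.range_zero, Finset.prod_empty, one_mul, zero_add, Finset.range_one,
        Finset.prod_singleton]
      rw [hz x _ hk]
      congr 1
      exact lintegral_congr fun z => (hz z _ (hF 1)).symm
    | succ n =>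
      have := ih (F := fun i w => if i = n + 1 then F (n + 1) w * ∫⁻ z, F (n + 2) z ∂P w else F i w)
        (fun i => by split_ifs; exacts [hk, hF i])
      rw [Finset.range_add_one] at this
      have e1 : ∀ y : ℕ → X, (∏ i ∈ insert (n + 1) (Finset.range (n + 1)),
          (fun (i : ℕ) (w : X) => if i = n + 1 then F (n + 1) w * ∫⁻ z, F (n + 2) z ∂P w else F i w)
            i (y i)) = (∏ i ∈ Finset.range (n + 1), F i (y i)) *
          (F (n + 1) (y (n + 1)) * ∫⁻ z, F (n + 2) z ∂P (y (n + 1))) := by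
        intro y
        rw [Finset.prod_insert (by simp), mul_comm]
        simp only [if_true]
        congr 1
        refine Finset.prod_congr rfl fun i hi => ?_
        rw [if_neg (by have := Finset.mem_range.1 hi; omega)]
      simp only [e1] at this
      rw [this]
      simp only [show ¬ (0 = n + 1) by omega, if_false]
      congr 1
      refine lintegral_congr fun z => ?_
      rw [last z n (fun i => F (i + 1)) fun i => hF _]
      refine lintegral_congr fun y => ?_
      rw [Finset.prod_range_succ]
      simp only [if_true]
      congr 1
      refine Finset.prod_congr rfl fun i hi => ?_
      rw [if_neg (by have := Finset.mem_range.1 hi; omega)]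

end OneStep

/-! ### Generating π-system of the path space -/

section Cylinders

variable {X : Type*} [MeasurableSpace X]

/-- The sets `{y | ∀ i < n, y i ∈ B i}` form a generating π-system of the space of sequences. -/
def boxes (X : Type*) [MeasurableSpace X] : Set (Set (ℕ → X)) :=
  {D | ∃ (n : ℕ) (B : ℕ → Set X), (∀ i, MeasurableSet (B i)) ∧ D = {y | ∀ i < n, y i ∈ B i}}

lemma isPiSystem_boxes : IsPiSystem (boxes X) := by
  rintro _ ⟨n, B, hB, rfl⟩ _ ⟨m, B', hB', rfl⟩ -
  classical
  refine ⟨max n m, fun i => (if i < n then B i else Set.univ) ∩ (if i < m then B' i else Set.univ),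
    fun i => ?_, ?_⟩
  · refine MeasurableSet.inter ?_ ?_ <;> split_ifs
    exacts [hB i, .univ, hB' i, .univ]
  · ext y
    simp only [Set.mem_inter_iff, Set.mem_ofPred_eq, lt_max_iff]
    constructor
    · rintro ⟨h1, h2⟩ i -
      refine ⟨?_, ?_⟩ <;> split_ifs with h
      exacts [h1 i h, trivial, h2 i h, trivial]
    · intro h
      refine ⟨fun i hi => ?_, fun i hi => ?_⟩
      · simpa [hi] using (h i (Or.inl hi)).1
      · simpa [hi] using (h i (Or.inr hi)).2

lemma generateFrom_boxes :
    (inferInstance : MeasurableSpace (ℕ → X)) = MeasurableSpace.generateFrom (boxes X) := by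
  refine le_antisymm ?_ (MeasurableSpace.generateFrom_le ?_)
  · refine iSup_le fun i => ?_
    rintro _ ⟨S, hS, rfl⟩
    classical
    refine MeasurableSpace.measurableSet_generateFrom
      ⟨i + 1, fun j => if j = i then S else Set.univ, fun j => ?_, ?_⟩
    · beta_reduce; split_ifs with h; exacts [by subst h; exact hS, .univ]
    · ext y
      simp only [Set.mem_preimage, Set.mem_ofPred_eq]
      constructor
      · intro h j _
        split_ifs with hj
        exacts [hj ▸ h, trivial]
      · intro h
        simpa using h i (by omega)
  · rintro _ ⟨n, B, hB, rfl⟩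
    have : {y : ℕ → X | ∀ i < n, y i ∈ B i} = ⋂ i ∈ Set.Iio n, (fun y => y i) ⁻¹' B i := by
      ext; simp
    rw [this]
    exact MeasurableSet.biInter (Set.to_countable _) fun i _ => measurable_pi_apply i (hB i)

end Cylinders

/-! ### Markov property at time one -/

section Markov

variable {X : Type*} [MeasurableSpace X] (P : Kernel X X) [IsMarkovKernel P]

/-- Conditioning on the first step: under `ℙ_x`, the chain is `x` followed by a chain started
at a point with distribution `P(x, ·)`. -/
lemma law_eq_bind (x : X) : law P x = (P x).bind ((law P).map (prepend x)) := by
  have hmk : IsMarkovKernel ((law P).map (prepend x)) :=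
    Kernel.IsMarkovKernel.map _ (measurable_prepend x)
  refine ext_of_generate_finite _ generateFrom_boxes isPiSystem_boxes ?_ (by simp)
  rintro _ ⟨n, B, hB, rfl⟩
  have hmeas : ∀ (n : ℕ) (B : ℕ → Set X), (∀ i, MeasurableSet (B i)) →
      MeasurableSet {y : ℕ → X | ∀ i < n, y i ∈ B i} := fun n B hB => by
    have h := (generateFrom_boxes (X := X)).symm.le
    exact h _ <| MeasurableSpace.measurableSet_generateFrom ⟨n, B, hB, rfl⟩
  have hprod : ∀ (w : X) (n : ℕ) (B : ℕ → Set X), (∀ i, MeasurableSet (B i)) →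
      law P w {y : ℕ → X | ∀ i < n, y i ∈ B i} =
      ∫⁻ y, ∏ i ∈ Finset.range n, (B i).indicator 1 (y i) ∂law P w := fun w n B hB => by
    rw [← lintegral_indicator_one (hmeas n B hB)]
    refine lintegral_congr fun y => ?_
    by_cases h : ∀ i < n, y i ∈ B i
    · rw [Set.indicator_of_mem (by exact h), Finset.prod_eq_one]
      · rfl
      · intro i hi
        rw [Set.indicator_of_mem (h i (Finset.mem_range.1 hi))]
        rfl
    · rw [Set.indicator_of_notMem (by exact h)]
      push Not at h
      obtain ⟨i, hi, h⟩ := h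
      exact (Finset.prod_eq_zero (Finset.mem_range.2 hi) (Set.indicator_of_notMem h _)).symm
  rw [Measure.bind_apply (hmeas n B hB) (Kernel.aemeasurable _)]
  cases n with
  | zero => simp
  | succ n =>
    rw [hprod x _ _ hB, lintegral_prod_succ P x n fun i => measurable_one.indicator (hB i)]
    simp only [Kernel.map_apply' _ (measurable_prepend x) _ (hmeas _ B hB)]
    by_cases h0 : x ∈ B 0
    · rw [Set.indicator_of_mem h0, Pi.one_apply, one_mul]
      refine lintegral_congr fun z => ?_
      rw [← hprod z n (fun i => B (i + 1)) fun i => hB _]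
      congr 1
      ext y
      simp only [Set.mem_preimage, Set.mem_ofPred_eq]
      constructor
      · rintro h (_ | i) hi
        exacts [h0, h i (by omega)]
      · exact fun h i hi => h (i + 1) (by omega)
    · rw [Set.indicator_of_notMem h0, zero_mul]
      symm
      rw [lintegral_eq_zero_iff' (Measurable.aemeasurable ?_)]
      · refine Eventually.of_forall fun z => ?_
        have : prepend x ⁻¹' {y : ℕ → X | ∀ i < n + 1, y i ∈ B i} = ∅ := by
          ext y
          simp only [Set.mem_preimage, Set.mem_ofPred_eq, Set.mem_empty_iff_false, iff_false]
          exact fun h => h0 (h 0 (by omega))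
        simp only [this, measure_empty, Pi.zero_apply]
      · exact (law P).measurable_coe (measurable_prepend x (hmeas _ B hB))

lemma lintegral_law (x : X) {F : (ℕ → X) → ℝ≥0∞} (hF : Measurable F) :
    ∫⁻ y, F y ∂law P x = ∫⁻ z, ∫⁻ y, F (prepend x y) ∂law P z ∂P x := by
  rw [law_eq_bind, Measure.lintegral_bind (Kernel.aemeasurable _) hF.aemeasurable]
  refine lintegral_congr fun z => ?_
  rw [Kernel.map_apply _ (measurable_prepend x), lintegral_map hF (measurable_prepend x)]

lemma lintegral_law_shift (x : X) {F : (ℕ → X) → ℝ≥0∞} (hF : Measurable F) :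
    ∫⁻ y, F (shift y) ∂law P x = ∫⁻ z, ∫⁻ y, F y ∂law P z ∂P x :=
  lintegral_law P x (hF.comp measurable_shift)

lemma law_shift (x : X) {D : Set (ℕ → X)} (hD : MeasurableSet D) :
    law P x (shift ⁻¹' D) = ∫⁻ z, law P z D ∂P x := by
  have := lintegral_law_shift P x (measurable_one.indicator hD : Measurable (D.indicator 1))
  simp only [lintegral_indicator_one hD] at this
  rw [← this, ← lintegral_indicator_one (measurable_shift hD)]
  rfl

end Markov

/-! ### Kernels acting on nonnegative functions -/

section Operator

variable {X Y Z : Type*} [MeasurableSpace X] [MeasurableSpace Y] [MeasurableSpace Z]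

/-- The action `κ f (x) = ∫ f(z) κ(x, dz)` of a kernel on nonnegative functions. -/
def kop (κ : Kernel X Y) (f : Y → ℝ≥0∞) (x : X) : ℝ≥0∞ := ∫⁻ z, f z ∂κ x

@[fun_prop]
lemma measurable_kop (κ : Kernel X Y) {f : Y → ℝ≥0∞} (hf : Measurable f) :
    Measurable (kop κ f) := hf.lintegral_kernel

lemma kop_mono (κ : Kernel X Y) {f g : Y → ℝ≥0∞} (h : ∀ z, f z ≤ g z) (x : X) :
    kop κ f x ≤ kop κ g x := lintegral_mono h

lemma kop_one (κ : Kernel X Y) (x : X) : kop κ (fun _ => 1) x = κ x Set.univ := by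
  simp [kop]

lemma kop_indicator (κ : Kernel X Y) {B : Set Y} (hB : MeasurableSet B) (x : X) :
    kop κ (B.indicator 1) x = κ x B := lintegral_indicator_one hB

lemma kop_iterate_measurable (κ : Kernel X X) {f : X → ℝ≥0∞} (hf : Measurable f) (n : ℕ) :
    Measurable ((kop κ)^[n] f) := by
  induction n with
  | zero => exact hf
  | succ n ih => rw [Function.iterate_succ_apply']; exact measurable_kop κ ih

lemma kop_iterate_mono (κ : Kernel X X) {f g : X → ℝ≥0∞} (h : ∀ z, f z ≤ g z) (n : ℕ) (x : X) :
    (kop κ)^[n] f x ≤ (kop κ)^[n] g x := by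
  induction n generalizing x with
  | zero => exact h x
  | succ n ih => rw [Function.iterate_succ_apply', Function.iterate_succ_apply']
                 exact kop_mono κ ih x

lemma kop_sum (κ : Kernel X Y) {f : ℕ → Y → ℝ≥0∞} (hf : ∀ k, Measurable (f k)) (s : Finset ℕ)
    (x : X) : kop κ (fun z => ∑ k ∈ s, f k z) x = ∑ k ∈ s, kop κ (f k) x :=
  lintegral_finsetSum s fun k _ => hf k

lemma kop_tsum (κ : Kernel X Y) {f : ℕ → Y → ℝ≥0∞} (hf : ∀ k, Measurable (f k))
    (x : X) : kop κ (fun z => ∑' k, f k z) x = ∑' k, kop κ (f k) x :=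
  lintegral_tsum fun k => (hf k).aemeasurable

lemma kop_comp (κ : Kernel X Y) (η : Kernel Y Z) {f : Z → ℝ≥0∞} (hf : Measurable f) (x : X) :
    kop (η ∘ₖ κ) f x = kop κ (kop η f) x :=
  Kernel.lintegral_comp η κ x hf

lemma lintegral_bind_kop (κ : Kernel X Y) (μ : Measure X) {f : Y → ℝ≥0∞} (hf : Measurable f) :
    ∫⁻ y, f y ∂(μ.bind κ) = ∫⁻ x, kop κ f x ∂μ :=
  Measure.lintegral_bind κ.aemeasurable hf.aemeasurable

lemma kop_congr_ae {κ : Kernel X Y} {f g : Y → ℝ≥0∞} {x : X} (h : ∀ᵐ z ∂κ x, f z = g z) :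
    kop κ f x = kop κ g x := lintegral_congr_ae h

lemma kop_mono_ae {κ : Kernel X Y} {f g : Y → ℝ≥0∞} {x : X} (h : ∀ᵐ z ∂κ x, f z ≤ g z) :
    kop κ f x ≤ kop κ g x := lintegral_mono_ae h

lemma lintegral_kop_of_invariant {κ : Kernel X X} {μ : Measure X} (h : κ.Invariant μ)
    {f : X → ℝ≥0∞} (hf : Measurable f) : ∫⁻ x, kop κ f x ∂μ = ∫⁻ x, f x ∂μ := by
  rw [← lintegral_bind_kop κ μ hf, h.def]

lemma ae_ae_of_invariant {κ : Kernel X X} {μ : Measure X} (h : κ.Invariant μ) {p : X → Prop}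
    (hp : ∀ᵐ x ∂μ, p x) : ∀ᵐ x ∂μ, ∀ᵐ z ∂κ x, p z := by
  rw [← h.def] at hp
  exact Measure.ae_ae_of_ae_comp hp

end Operator

/-! ### Recurrence and superharmonic functions -/

section PathLaw

variable {X : Type*} [MeasurableSpace X] (P : Kernel X X) [IsMarkovKernel P] {μ : Measure X}

lemma ae_lawFrom_iff (ν : Measure X) {p : (ℕ → X) → Prop} (hp : MeasurableSet {y | p y}) :
    (∀ᵐ y ∂lawFrom P ν, p y) ↔ ∀ᵐ x ∂ν, ∀ᵐ y ∂law P x, p y :=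
  Measure.ae_comp_iff hp

lemma measurePreserving_shift (h : P.Invariant μ) :
    MeasurePreserving shift (lawFrom P μ) (lawFrom P μ) := by
  refine ⟨measurable_shift, ?_⟩
  ext D hD
  rw [Measure.map_apply measurable_shift hD, lawFrom,
    Measure.bind_apply (measurable_shift hD) (Kernel.aemeasurable _),
    Measure.bind_apply hD (Kernel.aemeasurable _)]
  simp only [law_shift P _ hD]
  exact lintegral_kop_of_invariant h ((law P).measurable_coe hD)

lemma ae_ae_shift_of_ae {x : X} {p : (ℕ → X) → Prop} (hp : MeasurableSet {y | p y})  :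
    (∀ᵐ y ∂law P x, p (shift y)) ↔ ∀ᵐ z ∂P x, ∀ᵐ y ∂law P z, p y := by
  have h := law_shift P x hp.compl
  have h1 : (∀ᵐ y ∂law P x, p (shift y)) ↔ law P x (shift ⁻¹' {y | p y}ᶜ) = 0 := Iff.rfl
  rw [h1, h, lintegral_eq_zero_iff ((law P).measurable_coe hp.compl)]
  rfl

lemma lintegral_law_coord {g : X → ℝ≥0∞} (hg : Measurable g) (k : ℕ) (x : X) :
    ∫⁻ y, g (y k) ∂law P x = (kop P)^[k] g x := by
  induction k generalizing x with
  | zero =>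
    rw [lintegral_law_zero P x (F := fun a _ => g a) (hg.comp measurable_fst)]
    simp
  | succ k ih =>
    rw [Function.iterate_succ_apply', lintegral_law P x (F := fun y => g (y (k + 1)))
      (hg.comp (measurable_coord (k + 1)))]
    exact lintegral_congr fun z => ih z

lemma hitTime_lt_top_iff {X : Type*} {B : Set X} {y : ℕ → X} :
    hitTime B y < ⊤ ↔ ∃ n, y (n + 1) ∈ B := by
  simp only [hitTime, iInf_lt_top, Set.mem_ofPred_eq]
  constructor
  · rintro ⟨n, ⟨hn, h⟩, -⟩
    exact ⟨n - 1, by rwa [Nat.sub_add_cancel hn]⟩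
  · rintro ⟨n, h⟩
    exact ⟨n + 1, ⟨by omega, h⟩, ENat.natCast_lt_top _⟩

@[measurability]
lemma measurableSet_exists_mem {B : Set X} (hB : MeasurableSet B) :
    MeasurableSet {y : ℕ → X | ∃ n, y n ∈ B} := by
  simp only [Set.ofPred_exists]
  exact MeasurableSet.iUnion fun n => measurable_coord n hB

lemma measurableSet_frequently_mem {B : Set X} (hB : MeasurableSet B) :
    MeasurableSet {y : ℕ → X | ∃ᶠ n in atTop, y n ∈ B} := by
  simp only [frequently_atTop, Set.ofPred_forall, Set.ofPred_exists]
  exact MeasurableSet.iInter fun a => MeasurableSet.iUnion fun n =>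
    (MeasurableSet.const (n ≥ a)).inter (measurable_coord n hB)

lemma measurableSet_hitTime {B : Set X} (hB : MeasurableSet B) :
    MeasurableSet {y : ℕ → X | hitTime B y < ⊤} := by
  simp only [hitTime_lt_top_iff]
  exact measurable_shift (measurableSet_exists_mem hB)

lemma iterate_shift_apply {X : Type*} (n k : ℕ) (y : ℕ → X) : shift^[n] y k = y (k + n) := by
  induction n generalizing y with
  | zero => rfl
  | succ n ih => rw [Function.iterate_succ_apply, ih]; exact congrArg y (by omega)

variable {P}

/-- Under a recurrent invariant measure, a set is a.s. visited never or infinitely often. -/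
lemma IsRecurrent.ae_frequently [SigmaFinite μ] (hμ : IsRecurrent P μ) {B : Set X}
    (hB : MeasurableSet B) :
    ∀ᵐ y ∂lawFrom P μ, (∃ n, y n ∈ B) → ∃ᶠ n in atTop, y n ∈ B := by
  -- Recurrence speaks of sets of finite measure; σ-finiteness writes `B` as a countable union of
  -- such pieces, and returning to a piece is returning to `B`.
  have hret : ∀ᵐ x ∂μ, x ∈ B → ∀ᵐ y ∂law P x, ∃ n, y (n + 1) ∈ B := by
    have h := fun n => hμ.2 (B ∩ spanningSets μ n) (hB.inter (measurableSet_spanningSets μ n))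
      ((measure_mono Set.inter_subset_right).trans_lt (measure_spanningSets_lt_top μ n))
    filter_upwards [ae_all_iff.2 h] with x hx hxB
    obtain ⟨n, hn⟩ := Set.mem_iUnion.1 (iUnion_spanningSets μ ▸ Set.mem_univ x :
      x ∈ ⋃ n, spanningSets μ n)
    have := (prob_compl_eq_zero_iff (measurableSet_hitTime
      (hB.inter (measurableSet_spanningSets μ n)))).2 (hx n ⟨hxB, hn⟩)
    filter_upwards [measure_eq_zero_iff_ae_notMem.1 this] with y hy
    obtain ⟨k, hk⟩ := hitTime_lt_top_iff.1 (not_not.1 hy)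
    exact ⟨k, hk.1⟩
  have hm : MeasurableSet {y : ℕ → X | y 0 ∈ B → ∃ n, y (n + 1) ∈ B} :=
    MeasurableSet.imp (measurable_coord 0 hB) (measurable_shift (measurableSet_exists_mem hB))
  have h0 : ∀ᵐ y ∂lawFrom P μ, y 0 ∈ B → ∃ n, y (n + 1) ∈ B := by
    rw [ae_lawFrom_iff P μ hm]
    filter_upwards [hret] with x hx
    by_cases hxB : x ∈ B
    · filter_upwards [hx hxB] with y hy _ using hy
    · filter_upwards [(ae_law_zero P (p := fun x => x ∉ B) hB.compl).2 hxB] with y hy hy'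
      exact (hy hy').elim
  have h1 : ∀ᵐ y ∂lawFrom P μ, ∀ k, shift^[k] y 0 ∈ B → ∃ n, shift^[k] y (n + 1) ∈ B :=
    ae_all_iff.2 fun k =>
      ((measurePreserving_shift P hμ.1).iterate k).quasiMeasurePreserving.ae h0
  filter_upwards [h1] with y hy hex
  simp only [iterate_shift_apply, zero_add] at hy
  rw [frequently_atTop]
  intro a
  induction a with
  | zero => exact hex.imp fun n hn => ⟨Nat.zero_le n, hn⟩
  | succ a ih =>
    obtain ⟨b, hab, hb⟩ := ih
    obtain ⟨n, hn⟩ := hy b hb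
    exact ⟨n + 1 + b, by omega, hn⟩

/-- A bounded superharmonic function is harmonic a.e. with respect to a recurrent measure. -/
lemma IsRecurrent.kop_eq_of_le [SigmaFinite μ] (hμ : IsRecurrent P μ) {h : X → ℝ≥0∞}
    (hm : Measurable h) (h1 : ∀ x, h x ≤ 1) (hs : ∀ᵐ x ∂μ, kop P h x ≤ h x) :
    ∀ᵐ x ∂μ, kop P h x = h x := by
  set g : X → ℝ≥0∞ := fun x => h x - kop P h x with hg
  have hgm : Measurable g := hm.sub (measurable_kop P hm)
  -- Telescoping: one step later the partial sums are at most `kop P h`, and `kop P h + g = h`.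
  have hsum : ∀ n, ∀ᵐ x ∂μ, ∑ k ∈ Finset.range n, (kop P)^[k] g x ≤ h x := by
    intro n
    induction n with
    | zero => simp
    | succ n ih =>
      filter_upwards [ae_ae_of_invariant hμ.1 ih, hs] with x hx hsx
      rw [Finset.sum_range_succ']
      simp only [Function.iterate_succ_apply', Function.iterate_zero, id]
      rw [← kop_sum P (fun k => kop_iterate_measurable P hgm k)]
      calc _ ≤ kop P h x + g x := by gcongr; exact kop_mono_ae hx
        _ = h x := add_tsub_cancel_of_le hsx
  have htsum : ∀ᵐ x ∂μ, ∑' k, (kop P)^[k] g x ≤ 1 := by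
    filter_upwards [ae_all_iff.2 hsum] with x hx
    rw [ENNReal.tsum_eq_iSup_nat]
    exact iSup_le fun n => (hx n).trans (h1 x)
  -- Almost every path from a point with `g ≥ (m + 1)⁻¹` comes back to such points infinitely often,
  -- so that `∑ₖ g(yₖ)` is infinite although its expectation is at most one.
  have hbad : ∀ m : ℕ, ∀ᵐ x ∂μ, g x < ((m : ℝ≥0∞) + 1)⁻¹ := by
    intro m
    have hε : ((m : ℝ≥0∞) + 1)⁻¹ ≠ 0 := ENNReal.inv_ne_zero.2 (by finiteness)
    have hB : MeasurableSet {x | ((m : ℝ≥0∞) + 1)⁻¹ ≤ g x} := measurableSet_le measurable_const hgm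
    filter_upwards [Measure.ae_ae_of_ae_comp (hμ.ae_frequently hB), htsum] with x hx hxs
    by_contra hlt
    have hxB : ((m : ℝ≥0∞) + 1)⁻¹ ≤ g x := not_lt.1 hlt
    have hinf : ∀ᵐ y ∂law P x, ∑' k, g (y k) = ⊤ := by
      filter_upwards [hx, (ae_law_zero P hB).2 hxB] with y hy hy0
      by_contra hne
      have hfin := ENNReal.finite_const_le_of_tsum_ne_top hne hε
      exact Nat.frequently_atTop_iff_infinite.1 (hy ⟨0, hy0⟩) hfin
    have hint : ∫⁻ y, ∑' k, g (y k) ∂law P x = ∑' k, (kop P)^[k] g x := by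
      rw [lintegral_tsum (f := fun k (y : ℕ → X) => g (y k))
        fun k => (hgm.comp (measurable_coord k)).aemeasurable]
      exact tsum_congr fun k => lintegral_law_coord P hgm k x
    rw [lintegral_congr_ae hinf] at hint
    rw [← hint] at hxs
    simp at hxs
  filter_upwards [ae_all_iff.2 hbad, hs] with x hx hsx
  refine le_antisymm hsx (tsub_eq_zero_iff_le.1 ?_)
  by_contra hne
  obtain ⟨n, hn⟩ := ENNReal.exists_inv_nat_lt (a := g x) hne
  refine lt_irrefl _ ((hx n).trans (lt_of_le_of_lt (ENNReal.inv_le_inv.2 ?_) hn))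
  exact le_self_add

/-- A bounded superharmonic function is a.s. constant along the chain under a recurrent measure. -/
lemma IsRecurrent.ae_eq_of_le [SigmaFinite μ] (hμ : IsRecurrent P μ) {h : X → ℝ≥0∞}
    (hm : Measurable h) (h1 : ∀ x, h x ≤ 1) (hs : ∀ᵐ x ∂μ, kop P h x ≤ h x) :
    ∀ᵐ x ∂μ, ∀ᵐ z ∂P x, h z = h x := by
  -- Truncation preserves superharmonicity, so every truncation of `h` is harmonic as well.
  have hmin : ∀ c : ℝ≥0∞, ∀ᵐ x ∂μ, kop P (fun z => min (h z) c) x = min (h x) c := by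
    intro c
    refine hμ.kop_eq_of_le (hm.min measurable_const) (fun x => (min_le_left _ _).trans (h1 x)) ?_
    filter_upwards [hs] with x hx
    refine le_min ((kop_mono P (fun z => min_le_left _ _) x).trans hx) ?_
    refine (kop_mono P (g := fun _ => c) (fun z => min_le_right _ _) x).trans ?_
    simp [kop]
  have hq := ae_all_iff.2 fun q : ℚ => hmin ((Real.toNNReal q : NNReal) : ℝ≥0∞)
  filter_upwards [hq, hμ.kop_eq_of_le hm h1 hs] with x hx hxh
  -- At a level `q` below `h x`, the function `min h q` is at most `q` and has mean `q` under `P x`,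
  -- hence equals `q` almost surely. Countably many levels give `h ≥ h x`, and equality of the means
  -- then gives `h = h x`.
  have hge : ∀ᵐ z ∂P x, h x ≤ h z := by
    have : ∀ q : ℚ, ∀ᵐ z ∂P x, ((Real.toNNReal q : NNReal) : ℝ≥0∞) < h x →
        ((Real.toNNReal q : NNReal) : ℝ≥0∞) ≤ h z := by
      intro q
      by_cases hlt : ((Real.toNNReal q : NNReal) : ℝ≥0∞) < h x
      · have e := hx q
        rw [min_eq_right hlt.le] at e
        have := ae_eq_of_ae_le_of_lintegral_le (μ := P x)
          (f := fun z => min (h z) ((Real.toNNReal q : NNReal) : ℝ≥0∞))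
          (g := fun _ => ((Real.toNNReal q : NNReal) : ℝ≥0∞))
          (Eventually.of_forall fun z => min_le_right _ _)
          (by change kop P _ x ≠ ⊤; rw [e]; exact ENNReal.coe_ne_top) aemeasurable_const
          (by change _ ≤ kop P _ x; rw [e]; simp)
        filter_upwards [this] with z hz _ using min_eq_right_iff.1 hz
      · exact Eventually.of_forall fun z hz => (hlt hz).elim
    filter_upwards [ae_all_iff.2 this] with z hz
    refine le_of_forall_lt fun a ha => ?_
    obtain ⟨q, -, haq, hqx⟩ := ENNReal.lt_iff_exists_rat_btwn.1 ha
    exact haq.trans_le (hz q hqx)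
  have hfin : h x ≠ ⊤ := ((h1 x).trans_lt ENNReal.one_lt_top).ne
  have := ae_eq_of_ae_le_of_lintegral_le (μ := P x) (f := fun _ => h x) (g := h) hge
    (by simpa using hfin) hm.aemeasurable (by change kop P h x ≤ _; rw [hxh]; simp)
  filter_upwards [this] with z hz using hz.symm

/-- Under an irreducible measure, a function that is a.s. constant along the chain is constant. -/
lemma IsIrreducibleMeasure.exists_ae_eq_const (hirr : IsIrreducibleMeasure P μ) {h : X → ℝ≥0∞}
    (hm : Measurable h) (hc : ∀ᵐ x ∂μ, ∀ᵐ z ∂P x, h z = h x) : ∃ c, ∀ᵐ x ∂μ, h x = c := by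
  -- The preimage of each measurable set is invariant, hence null or conull; countably many
  -- measurable sets separate the values, so one value is taken almost everywhere.
  refine exists_eventuallyEq_const_of_forall_separating (l := ae μ) (f := h) MeasurableSet
    fun U hU => ?_
  have := hirr.2 (h ⁻¹' U) (hm hU) ?_
  · rcases this with h0 | h0
    · exact Or.inr (measure_eq_zero_iff_ae_notMem.1 h0)
    · refine Or.inl ?_
      filter_upwards [measure_eq_zero_iff_ae_notMem.1 h0] with x hx using not_not.1 hx
  · filter_upwards [hc] with x hx
    by_cases hxU : h x ∈ U
    · rw [Set.indicator_of_mem (by exact hxU), Pi.one_apply, ← prob_compl_eq_zero_iff (hm hU),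
        measure_eq_zero_iff_ae_notMem]
      filter_upwards [hx] with z hz
      rwa [Set.notMem_compl_iff, Set.mem_preimage, hz]
    · rw [Set.indicator_of_notMem (by exact hxU), measure_eq_zero_iff_ae_notMem]
      filter_upwards [hx] with z hz
      rwa [Set.mem_preimage, hz]

end PathLaw

/-! ### From irreducibility to ergodicity of the shift -/

section ErgodicShift

variable {X : Type*} [MeasurableSpace X] {P : Kernel X X} [IsMarkovKernel P] {μ : Measure X}

lemma law_zero_inter (x : X) {B : Set X} (hB : MeasurableSet B) (D : Set (ℕ → X)) :
    law P x ({y | y 0 ∈ B} ∩ D) = B.indicator 1 x * law P x D := by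
  by_cases hx : x ∈ B
  · rw [Set.indicator_of_mem hx, Pi.one_apply, one_mul]
    refine measure_congr ?_
    filter_upwards [(ae_law_zero P hB).2 hx] with y hy
    exact propext ⟨fun h => h.2, fun h => ⟨hy, h⟩⟩
  · rw [Set.indicator_of_notMem hx, zero_mul, measure_eq_zero_iff_ae_notMem]
    filter_upwards [(ae_law_zero P (p := fun x => x ∉ B) hB.compl).2 hx] with y hy h
    exact hy h.1

/-- By the Markov property, the probability of a shift-invariant event is a harmonic function of the
starting point. -/
lemma IsRecurrent.ae_law_eq_of_shift_invariant [SigmaFinite μ] (hμ : IsRecurrent P μ)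
    {D : Set (ℕ → X)} (hD : MeasurableSet D) (hinv : shift ⁻¹' D = D) :
    ∀ᵐ x ∂μ, ∀ᵐ z ∂P x, law P z D = law P x D := by
  refine hμ.ae_eq_of_le ((law P).measurable_coe hD) (fun x => prob_le_one)
    (Eventually.of_forall fun x => ?_)
  rw [← hinv, law_shift P x hD, hinv]
  rfl

/-- Under an irreducible recurrent measure, the shift is ergodic. -/
lemma IsIrreducibleMeasure.isErgodic [SigmaFinite μ] (hirr : IsIrreducibleMeasure P μ)
    (hμ : IsRecurrent P μ) : IsErgodic P μ := by
  refine ⟨hμ.1, ⟨measurePreserving_shift P hμ.1, ⟨fun D hD hinv => ?_⟩⟩⟩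
  obtain ⟨c, hc⟩ := hirr.exists_ae_eq_const ((law P).measurable_coe hD)
    (hμ.ae_law_eq_of_shift_invariant hD hinv)
  -- `D` is independent of every box: being shift-invariant, it passes unchanged through the first
  -- step, which removes one coordinate of the box.
  have hbox : ∀ (n : ℕ) (B : ℕ → Set X), (∀ i, MeasurableSet (B i)) →
      ∀ᵐ x ∂μ, law P x ({y | ∀ i < n, y i ∈ B i} ∩ D) = c * law P x {y | ∀ i < n, y i ∈ B i} := by
    intro n
    induction n with
    | zero =>
      intro B hB
      filter_upwards [hc] with x hx
      simpa using hx
    | succ n ih =>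
      intro B hB
      have hm : MeasurableSet {y : ℕ → X | ∀ i < n, y i ∈ B (i + 1)} :=
        (generateFrom_boxes (X := X)).symm.le _ <|
          MeasurableSpace.measurableSet_generateFrom ⟨n, fun i => B (i + 1), fun i => hB _, rfl⟩
      filter_upwards [ae_ae_of_invariant hμ.1 (ih (fun i => B (i + 1)) fun i => hB _)] with x hx
      have e : {y : ℕ → X | ∀ i < n + 1, y i ∈ B i} =
          {y | y 0 ∈ B 0} ∩ shift ⁻¹' {y | ∀ i < n, y i ∈ B (i + 1)} := by
        ext y
        constructor
        · exact fun h => ⟨h 0 (by omega), fun i hi => h (i + 1) (by omega)⟩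
        · rintro ⟨h0, h⟩ (_ | i) hi
          exacts [h0, h i (by omega)]
      have e2 : {y : ℕ → X | ∀ i < n + 1, y i ∈ B i} ∩ D =
          {y | y 0 ∈ B 0} ∩ shift ⁻¹' ({y | ∀ i < n, y i ∈ B (i + 1)} ∩ D) := by
        rw [e, Set.preimage_inter, hinv, Set.inter_assoc]
      rw [e2, e, law_zero_inter x (hB 0), law_zero_inter x (hB 0), law_shift P x (hm.inter hD),
        law_shift P x hm, lintegral_congr_ae hx, lintegral_const_mul _ ((law P).measurable_coe hm)]
      ring
  have hall : ∀ F : Set (ℕ → X), MeasurableSet F →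
      ∀ᵐ x ∂μ, law P x (F ∩ D) = c * law P x F := by
    refine MeasurableSpace.induction_on_inter generateFrom_boxes isPiSystem_boxes ?_ ?_ ?_ ?_
    · simp
    · rintro _ ⟨n, B, hB, rfl⟩
      exact hbox n B hB
    · intro F hF h
      filter_upwards [h, hc] with x hx hcx
      have h1 := measure_inter_add_sdiff (μ := law P x) D hF
      have h2 := prob_add_prob_compl (μ := law P x) hF
      have hc1 : c ≤ 1 := hcx ▸ prob_le_one
      have hne : c * law P x F ≠ ⊤ :=
        (ENNReal.mul_lt_top (hc1.trans_lt ENNReal.one_lt_top) (measure_lt_top _ _)).ne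
      rw [hcx, Set.inter_comm, hx] at h1
      have h3 : c * law P x F + c * law P x Fᶜ = c := by rw [← mul_add, h2, mul_one]
      rw [Set.inter_comm, ← Set.sdiff_eq]
      exact (ENNReal.add_right_inj hne).1 (h1.trans h3.symm)
    · intro f hd hf h
      filter_upwards [ae_all_iff.2 h] with x hx
      rw [Set.iUnion_inter, measure_iUnion (fun i j hij => (hd hij).mono Set.inter_subset_left
        Set.inter_subset_left) fun i => (hf i).inter hD, measure_iUnion hd hf,
        ← ENNReal.tsum_mul_left]
      exact tsum_congr hx
  -- Independence of `D` from itself gives `c = c * c`, so `c` is 0 or 1.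
  have hcc : ∀ᵐ x ∂μ, law P x D = 0 ∨ law P x D = 1 := by
    filter_upwards [hall D hD, hc] with x hx hcx
    rw [Set.inter_self, hcx] at hx
    by_cases h0 : c = 0
    · exact Or.inl (hcx.trans h0)
    · refine Or.inr (hcx.trans ?_)
      have hc1 : c ≤ 1 := hcx ▸ prob_le_one
      exact ((ENNReal.mul_eq_left h0 (hc1.trans_lt ENNReal.one_lt_top).ne).1 hx.symm)
  rw [eventuallyConst_set]
  by_cases h1 : c = 1
  · refine Or.inl ((ae_lawFrom_iff P μ hD).2 ?_)
    filter_upwards [hc] with x hx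
    filter_upwards [measure_eq_zero_iff_ae_notMem.1
      ((prob_compl_eq_zero_iff hD).2 (hx.trans h1))] with y hy using not_not.1 hy
  · refine Or.inr ((ae_lawFrom_iff P μ hD.compl).2 ?_)
    filter_upwards [hc, hcc] with x hx hx2
    rcases hx2 with h0 | h0
    · exact measure_eq_zero_iff_ae_notMem.1 h0
    · exact (h1 (hx.symm.trans h0)).elim

end ErgodicShift

/-! ### Excessive measures with the return property -/

section Excessive

variable {X : Type*} [MeasurableSpace X] {P : Kernel X X} [IsMarkovKernel P] {ν : Measure X}

/-- A visit at a positive time is a visit of the shifted path at some time, time 0 included. -/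
lemma kop_law_exists_mem {B : Set X} (hB : MeasurableSet B) (x : X) :
    kop P (fun z => law P z {y | ∃ n, y n ∈ B}) x = law P x {y | hitTime B y < ⊤} := by
  have := law_shift P x (measurableSet_exists_mem hB)
  rw [kop, ← this]
  simp only [hitTime_lt_top_iff]
  rfl

/-- A σ-finite excessive measure from which the chain returns to every set of finite measure is
invariant. -/
lemma isRecurrent_of_excessive [SigmaFinite ν] (hexc : ν.bind P ≤ ν)
    (hret : ∀ B : Set X, MeasurableSet B → ν B < ∞ →
      ∀ᵐ x ∂ν, x ∈ B → law P x {y | hitTime B y < ⊤} = 1) : IsRecurrent P ν := by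
  refine ⟨?_, hret⟩
  have hkop : ∀ f : X → ℝ≥0∞, Measurable f → ∫⁻ x, kop P f x ∂ν ≤ ∫⁻ x, f x ∂ν := by
    intro f hf
    rw [← lintegral_bind_kop P ν hf]
    exact lintegral_mono' hexc le_rfl
  have hfin : ∀ B : Set X, MeasurableSet B → ν B < ∞ → ν B ≤ ν.bind P B := by
    intro B hB hνB
    have hDm : ∀ n, MeasurableSet {y : ℕ → X | ∃ k < n, y k ∈ B} := fun n => by
      simp only [Set.ofPred_exists]
      exact MeasurableSet.iUnion fun k =>
        (MeasurableSet.const (k < n)).inter (measurable_coord k hB)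
    -- The probability of visiting `B` at one of the times `0, …, n`.
    set f : ℕ → X → ℝ≥0∞ := fun n x => law P x {y | ∃ k < n + 1, y k ∈ B} with hf
    have hfm : ∀ n, Measurable (f n) := fun n => (law P).measurable_coe (hDm (n + 1))
    have hf1 : ∀ n x, f n x ≤ 1 := fun n x => prob_le_one
    have hPf1 : ∀ n x, kop P (f n) x ≤ 1 := fun n x =>
      (kop_mono P (hf1 n) x).trans (by simp [kop_one])
    have hPf : ∀ n x, kop P (f n) x = law P x {y | ∃ k < n + 1, y (k + 1) ∈ B} :=
      fun n x => (law_shift P x (hDm (n + 1))).symm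
    have hin : ∀ n, ∀ x ∈ B, f n x = 1 := by
      intro n x hx
      refine (prob_compl_eq_zero_iff (μ := law P x) (hDm (n + 1))).1 ?_
      rw [measure_eq_zero_iff_ae_notMem]
      filter_upwards [(ae_law_zero P hB).2 hx] with y hy
      exact not_not.2 ⟨0, by omega, hy⟩
    have hout : ∀ n, ∀ x ∉ B, f (n + 1) x = kop P (f n) x := by
      intro n x hx
      rw [hPf]
      refine measure_congr ?_
      filter_upwards [(ae_law_zero P (p := fun x => x ∉ B) hB.compl).2 hx] with y hy
      refine propext ⟨?_, ?_⟩
      · rintro ⟨_ | k, hk, h⟩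
        exacts [(hy h).elim, ⟨k, by omega, h⟩]
      · rintro ⟨k, hk, h⟩
        exact ⟨k + 1, by omega, h⟩
    -- The mass of the starting points in `B` weighted by the probability of no return at the times
    -- `1, …, n + 1`.
    set ε : ℕ → ℝ≥0∞ := fun n => ∫⁻ x in B, (1 - kop P (f n) x) ∂ν with hε
    have hstep : ∀ n, ∫⁻ x, f (n + 1) x ∂ν = ∫⁻ x, kop P (f n) x ∂ν + ε n := by
      intro n
      rw [hε]
      beta_reduce
      rw [← lintegral_indicator hB, ← lintegral_add_left (measurable_kop P (hfm n))]
      refine lintegral_congr fun x => ?_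
      by_cases hx : x ∈ B
      · rw [Set.indicator_of_mem hx, hin _ x hx, add_tsub_cancel_of_le (hPf1 n x)]
      · rw [Set.indicator_of_notMem hx, add_zero, hout n x hx]
    have hεle : ∀ n, ε n ≤ ν B := fun n =>
      (lintegral_mono (g := fun _ => 1) fun x => tsub_le_self).trans (by simp)
    have hffin : ∀ n, ∫⁻ x, f n x ∂ν ≠ ⊤ := by
      intro n
      induction n with
      | zero =>
        have : ∀ x, f 0 x = B.indicator 1 x := by
          intro x
          have h := law_zero_inter (P := P) x hB Set.univ
          simpa [hf] using h
        rw [lintegral_congr this, lintegral_indicator_one hB]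
        exact hνB.ne
      | succ n ih =>
        rw [hstep]
        exact ENNReal.add_ne_top.2 ⟨ne_top_of_le_ne_top ih (hkop _ (hfm n)),
          ne_top_of_le_ne_top hνB.ne (hεle n)⟩
    have hmono : ∀ n x, f n x ≤ f (n + 1) x := fun n x =>
      measure_mono fun y ⟨k, hk, h⟩ => ⟨k, by omega, h⟩
    have hB1 : ∀ n x, B.indicator 1 x ≤ f n x := by
      intro n x
      by_cases hx : x ∈ B
      · rw [hin n x hx]; exact Set.indicator_le_self' (by simp) x
      · simp [hx]
    have hone : Measurable (B.indicator (1 : X → ℝ≥0∞)) := measurable_one.indicator hB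
    -- Only the part `f n - 1_B` is estimated by excessivity; on `1_B` the exact value `ν.bind P B`
    -- is kept. Since `f n ≤ f (n + 1)`, the finite integral of `f n - 1_B` cancels from both sides.
    have hkey : ∀ n, ν B ≤ ν.bind P B + ε n := by
      intro n
      have hdecomp : ∀ x, f n x = B.indicator 1 x + (f n x - B.indicator 1 x) := fun x =>
        (add_tsub_cancel_of_le (hB1 n x)).symm
      have hem : Measurable fun x => f n x - B.indicator 1 x := (hfm n).sub hone
      have e1 : ∫⁻ x, f n x ∂ν = ν B + ∫⁻ x, (f n x - B.indicator 1 x) ∂ν := by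
        rw [lintegral_congr hdecomp, lintegral_add_left hone, lintegral_indicator_one hB]
      have e2 : ∫⁻ x, kop P (f n) x ∂ν ≤ ν.bind P B + ∫⁻ x, (f n x - B.indicator 1 x) ∂ν := by
        rw [← lintegral_bind_kop P ν (hfm n), lintegral_congr hdecomp, lintegral_add_left hone,
          lintegral_indicator_one hB, lintegral_bind_kop P ν hem]
        exact add_le_add le_rfl (hkop _ hem)
      have e3 : ∫⁻ x, f n x ∂ν ≤ ∫⁻ x, kop P (f n) x ∂ν + ε n :=
        hstep n ▸ lintegral_mono (hmono n)
      have e4 : ∫⁻ x, (f n x - B.indicator 1 x) ∂ν ≠ ⊤ :=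
        ne_top_of_le_ne_top (hffin n) (lintegral_mono fun x => tsub_le_self)
      rw [← ENNReal.add_le_add_iff_right e4, ← e1]
      calc _ ≤ ∫⁻ x, kop P (f n) x ∂ν + ε n := e3
        _ ≤ ν.bind P B + ∫⁻ x, (f n x - B.indicator 1 x) ∂ν + ε n := by gcongr
        _ = _ := by ring
    have hlim : Tendsto ε atTop (nhds 0) := by
      have h0 : ∫⁻ _ in B, (0 : ℝ≥0∞) ∂ν = 0 := by simp
      rw [← h0]
      refine tendsto_lintegral_of_dominated_convergence (fun _ => 1)
        (fun n => measurable_const.sub (measurable_kop P (hfm n)))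
        (fun n => Eventually.of_forall fun x => tsub_le_self) (by simpa using hνB.ne) ?_
      filter_upwards [(ae_restrict_iff' hB).2 (hret B hB hνB)] with x hx
      have hu : {y : ℕ → X | hitTime B y < ⊤} = ⋃ n, {y | ∃ k < n + 1, y (k + 1) ∈ B} := by
        ext y
        simp only [hitTime_lt_top_iff, Set.mem_iUnion, Set.mem_ofPred_eq]
        exact ⟨fun ⟨n, h⟩ => ⟨n, n, by omega, h⟩, fun ⟨_, n, _, h⟩ => ⟨n, h⟩⟩
      have ht : Tendsto (fun n => kop P (f n) x) atTop (nhds 1) := by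
        rw [← hx, hu]
        simp only [hPf]
        exact tendsto_measure_iUnion_atTop fun a b hab y ⟨k, hk, h⟩ => ⟨k, by omega, h⟩
      have := ENNReal.Tendsto.sub (tendsto_const_nhds (x := (1 : ℝ≥0∞))) ht (Or.inl (by simp))
      simpa using this
    refine ge_of_tendsto' (f := fun n => ν.bind P B + ε n) (x := atTop) ?_ hkey
    simpa using tendsto_const_nhds.add hlim
  refine le_antisymm hexc (Measure.le_iff.2 fun B hB => ?_)
  have hU : B = ⋃ n, B ∩ spanningSets ν n := by
    rw [← Set.inter_iUnion, iUnion_spanningSets, Set.inter_univ]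
  have hmon : Monotone fun n => B ∩ spanningSets ν n := fun a b hab =>
    Set.inter_subset_inter_right _ (monotone_spanningSets ν hab)
  rw [hU, hmon.measure_iUnion]
  refine iSup_le fun n => (hfin _ (hB.inter (measurableSet_spanningSets ν n))
    ((measure_mono Set.inter_subset_right).trans_lt (measure_spanningSets_lt_top ν n))).trans ?_
  exact measure_mono (Set.subset_iUnion (fun n => B ∩ spanningSets ν n) n)

end Excessive

/-! ### Potentials and telescoping -/

section Green

variable {X : Type*} [MeasurableSpace X] {P P₀ J : Kernel X X} {μ : Measure X}

/-- The potential `∑ₖ P₀ᵏ φ` of a nonnegative function. -/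
def green (P₀ : Kernel X X) (φ : X → ℝ≥0∞) (x : X) : ℝ≥0∞ := ∑' k, (kop P₀)^[k] φ x

@[fun_prop]
lemma measurable_green {φ : X → ℝ≥0∞} (hφ : Measurable φ) : Measurable (green P₀ φ) :=
  Measurable.tsum fun k => kop_iterate_measurable P₀ hφ k

lemma green_eq {φ : X → ℝ≥0∞} (hφ : Measurable φ) (x : X) :
    green P₀ φ x = φ x + kop P₀ (green P₀ φ) x := by
  have : kop P₀ (green P₀ φ) x = ∑' k, kop P₀ ((kop P₀)^[k] φ) x :=
    kop_tsum P₀ (fun k => kop_iterate_measurable P₀ hφ k) x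
  rw [this, green, tsum_eq_zero_add' ENNReal.summable]
  simp only [Function.iterate_succ_apply', Function.iterate_zero, id]

lemma green_mono {φ ψ : X → ℝ≥0∞} (h : ∀ x, φ x ≤ ψ x) (x : X) : green P₀ φ x ≤ green P₀ ψ x :=
  ENNReal.tsum_le_tsum fun k => kop_iterate_mono P₀ h k x

lemma kop_add_apply (hP : P = P₀ + J) (f : X → ℝ≥0∞) (x : X) :
    kop P f x = kop P₀ f x + kop J f x := by
  rw [kop, hP, add_apply, lintegral_add_measure]; rfl

/-- For the largest admissible `φ`, the mass of `J`, the partial sum over `n` terms is the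
probability of using `J` within `n` steps. -/
lemma green_le_one [IsMarkovKernel P] (hP : P = P₀ + J) {φ : X → ℝ≥0∞} (hφ : Measurable φ)
    (hφJ : ∀ x, φ x ≤ J x Set.univ) (x : X) : green P₀ φ x ≤ 1 := by
  rw [green, ENNReal.tsum_eq_iSup_nat]
  refine iSup_le fun n => ?_
  induction n generalizing x with
  | zero => simp
  | succ n ih =>
    rw [Finset.sum_range_succ']
    simp only [Function.iterate_succ_apply', Function.iterate_zero, id]
    rw [← kop_sum P₀ (fun k => kop_iterate_measurable P₀ hφ k)]
    calc _ ≤ kop P₀ (fun _ => 1) x + kop J (fun _ => 1) x := by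
          rw [kop_one J]
          exact add_le_add (kop_mono P₀ ih x) (hφJ x)
      _ = 1 := by rw [← kop_add_apply hP, kop_one, measure_univ]

/-- Each further term comes from inserting one step of `P`, free of charge by invariance, and
splitting it into `P₀` and `J`. -/
lemma sum_lintegral_add (hP : P = P₀ + J) (hμ : P.Invariant μ)
    {φ : X → ℝ≥0∞} (hφ : Measurable φ) (n : ℕ) :
    ∑ k ∈ Finset.range n, ∫⁻ x, kop J ((kop P₀)^[k] φ) x ∂μ + ∫⁻ x, (kop P₀)^[n] φ x ∂μ =
      ∫⁻ x, φ x ∂μ := by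
  induction n with
  | zero => simp
  | succ n ih =>
    have hm := kop_iterate_measurable P₀ hφ n
    rw [← ih, Finset.sum_range_succ, add_assoc, ← lintegral_kop_of_invariant hμ hm,
      ← lintegral_add_left (measurable_kop J hm)]
    congr 1
    refine lintegral_congr fun x => ?_
    rw [kop_add_apply hP, add_comm, Function.iterate_succ_apply']

lemma lintegral_kop_green {φ : X → ℝ≥0∞} (hφ : Measurable φ) :
    ∫⁻ x, kop J (green P₀ φ) x ∂μ = ∑' k, ∫⁻ x, kop J ((kop P₀)^[k] φ) x ∂μ := by
  have hm := fun k => kop_iterate_measurable P₀ hφ k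
  rw [← lintegral_tsum fun k => (measurable_kop J (hm k)).aemeasurable]
  exact lintegral_congr fun x => kop_tsum J hm x

lemma lintegral_kop_green_le (hP : P = P₀ + J) (hμ : P.Invariant μ)
    {φ : X → ℝ≥0∞} (hφ : Measurable φ) :
    ∫⁻ x, kop J (green P₀ φ) x ∂μ ≤ ∫⁻ x, φ x ∂μ := by
  rw [lintegral_kop_green hφ, ENNReal.tsum_eq_iSup_nat]
  exact iSup_le fun n => (sum_lintegral_add hP hμ hφ n) ▸ le_self_add

/-- The remainder in `sum_lintegral_add` is all that can be lost in the limit. -/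
lemma lintegral_kop_green_eq_of_tendsto (hP : P = P₀ + J) (hμ : P.Invariant μ)
    {φ : X → ℝ≥0∞} (hφ : Measurable φ)
    (h0 : Tendsto (fun n => ∫⁻ x, (kop P₀)^[n] φ x ∂μ) atTop (nhds 0)) :
    ∫⁻ x, kop J (green P₀ φ) x ∂μ = ∫⁻ x, φ x ∂μ := by
  rw [lintegral_kop_green hφ]
  have h1 := (ENNReal.tendsto_nat_tsum fun k => ∫⁻ x, kop J ((kop P₀)^[k] φ) x ∂μ).add h0
  simp only [sum_lintegral_add hP hμ hφ, add_zero] at h1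
  exact tendsto_nhds_unique h1 tendsto_const_nhds

/-- Converse of the preceding fact; finiteness of the integral is what allows the remainder to be
recovered by subtraction. -/
lemma tendsto_lintegral_iterate_zero (hP : P = P₀ + J) (hμ : P.Invariant μ)
    {φ : X → ℝ≥0∞} (hφ : Measurable φ)
    (hfin : ∫⁻ x, φ x ∂μ ≠ ⊤) (he : ∫⁻ x, kop J (green P₀ φ) x ∂μ = ∫⁻ x, φ x ∂μ) :
    Tendsto (fun n => ∫⁻ x, (kop P₀)^[n] φ x ∂μ) atTop (nhds 0) := by
  rw [lintegral_kop_green hφ] at he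
  have h1 := ENNReal.tendsto_nat_tsum fun k => ∫⁻ x, kop J ((kop P₀)^[k] φ) x ∂μ
  rw [he] at h1
  have h2 := ENNReal.Tendsto.sub (tendsto_const_nhds (x := ∫⁻ x, φ x ∂μ)) h1 (Or.inl hfin)
  rw [tsub_self] at h2
  refine h2.congr fun n => ?_
  have h3 := sum_lintegral_add hP hμ hφ n
  rw [← h3]
  refine ENNReal.add_sub_cancel_left (ne_top_of_le_ne_top hfin ?_)
  rw [← h3]
  exact le_self_add

end Green

/-! ### Induced chains: recurrence, irreducibility and Kac's formula -/

section Trace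

variable {X S : Type*} [MeasurableSpace X] [MeasurableSpace S]

/-- The chain `Q` on `S ∪ {†}` is induced by the chain with transition kernel `P = P₀ + J`, where
`J = Ψ ∘ Φ` factors through `S`: a step of `Q` consists of a step of `Ψ`, of any number of
steps of `P₀` and of a step of `Φ`. -/
structure IsInduced (P P₀ J : Kernel X X) (Φ : Kernel X S) (Ψ : Kernel S X)
    (Q : Kernel (Option S) (Option S)) (μ : Measure X) : Prop where
  split : P = P₀ + J
  comp : Ψ ∘ₖ Φ = J
  mass : ∀ x, Φ x Set.univ = J x Set.univ
  -- Only an inequality at a general `s`: the left side ignores `f none`, whereas `Q` may move to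
  -- `†`. Equality needs the next jump to occur almost surely.
  kop_le : ∀ (s : S) (f : Option S → ℝ≥0∞), Measurable f →
    kop Ψ (green P₀ (kop Φ (f ∘ some))) s ≤ kop Q f (some s)
  kop_eq : ∀ᵐ s ∂(μ.bind Φ), ∀ f : Option S → ℝ≥0∞, Measurable f →
    kop Ψ (green P₀ (kop Φ (f ∘ some))) s = kop Q f (some s)
  mass_eq_one : ∀ᵐ s ∂(μ.bind Φ), Ψ s Set.univ = 1

lemma measurableEmbedding_some : MeasurableEmbedding (some : S → Option S) where
  injective := Option.some_injective S
  measurable := measurable_some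
  measurableSet_image' := fun {s} hs => by
    change MeasurableSet (some ⁻¹' (some '' s))
    rwa [Set.preimage_image_eq _ (Option.some_injective S)]

lemma ae_extendMeasure_iff {ν : Measure S} {p : Option S → Prop} :
    (∀ᵐ o ∂extendMeasure ν, p o) ↔ ∀ᵐ s ∂ν, p (some s) :=
  measurableEmbedding_some.ae_map_iff

variable {P P₀ J : Kernel X X} {Φ : Kernel X S} {Ψ : Kernel S X}
  {Q : Kernel (Option S) (Option S)} {μ : Measure X}

namespace IsInduced

lemma kop_J (h : IsInduced P P₀ J Φ Ψ Q μ)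
    {f : X → ℝ≥0∞} (hf : Measurable f) (x : X) : kop J f x = kop Φ (kop Ψ f) x := by
  rw [← h.comp, kop_comp Φ Ψ hf]

lemma lintegral_kop_entry (h : IsInduced P P₀ J Φ Ψ Q μ)
    {f : X → ℝ≥0∞} (hf : Measurable f) :
    ∫⁻ s, kop Ψ f s ∂(μ.bind Φ) = ∫⁻ x, kop J f x ∂μ := by
  rw [lintegral_bind_kop Φ μ (measurable_kop Ψ hf)]
  exact lintegral_congr fun x => (h.kop_J hf x).symm

lemma lintegral_kop_extend (h : IsInduced P P₀ J Φ Ψ Q μ)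
    {f : Option S → ℝ≥0∞} (hf : Measurable f) :
    ∫⁻ o, kop Q f o ∂extendMeasure (μ.bind Φ) =
      ∫⁻ x, kop J (green P₀ (kop Φ (f ∘ some))) x ∂μ := by
  have hm : Measurable (kop Φ (f ∘ some)) := measurable_kop Φ (hf.comp measurable_some)
  rw [extendMeasure, lintegral_map (measurable_kop Q hf) measurable_some,
    ← h.lintegral_kop_entry (measurable_green hm)]
  refine lintegral_congr_ae ?_
  filter_upwards [h.kop_eq] with s hs using (hs f hf).symm

/-- The telescoping bound, applied to the mark `φ = Φ (f ∘ some)` of the indicator `f` of a set. -/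
lemma bind_le (h : IsInduced P P₀ J Φ Ψ Q μ)
    (hμ : P.Invariant μ) :
    (extendMeasure (μ.bind Φ)).bind Q ≤ extendMeasure (μ.bind Φ) := by
  refine Measure.le_iff.2 fun B hB => ?_
  have hf : Measurable (B.indicator (1 : Option S → ℝ≥0∞)) := measurable_one.indicator hB
  have hm : Measurable ((B.indicator (1 : Option S → ℝ≥0∞)) ∘ some) := hf.comp measurable_some
  rw [← lintegral_indicator_one hB, lintegral_bind_kop Q _ hf, h.lintegral_kop_extend hf]
  refine (lintegral_kop_green_le h.split hμ (measurable_kop Φ hm)).trans ?_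
  rw [← lintegral_bind_kop Φ μ hm, ← lintegral_indicator_one hB, extendMeasure,
    lintegral_map hf measurable_some]
  rfl

lemma kop_mark_le (h : IsInduced P P₀ J Φ Ψ Q μ)
    {f : Option S → ℝ≥0∞} (hf1 : ∀ o, f o ≤ 1) (x : X) :
    kop Φ (f ∘ some) x ≤ J x Set.univ := by
  rw [← h.mass, ← kop_one]
  exact kop_mono Φ (fun s => hf1 _) x

variable [IsMarkovKernel P] [SigmaFinite μ]

/-- The lift `g = G Φ f` satisfies `J g = Φ Ψ g ≤ Φ f`, so `P g = P₀ g + J g ≤ P₀ g + Φ f = g`.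
Recurrence makes this an equality, hence `Φ Ψ g = Φ f`; as `Ψ g ≤ Q f ≤ f` pointwise, all three
agree almost everywhere. -/
lemma kop_eq_of_superharmonic (h : IsInduced P P₀ J Φ Ψ Q μ)
    (hμ : IsRecurrent P μ) {f : Option S → ℝ≥0∞} (hf : Measurable f)
    (hf1 : ∀ o, f o ≤ 1) (hs : ∀ o, kop Q f o ≤ f o) :
    ∀ᵐ s ∂(μ.bind Φ), kop Q f (some s) = f (some s) := by
  have hfs : Measurable (f ∘ some) := hf.comp measurable_some
  have hm : Measurable (kop Φ (f ∘ some)) := measurable_kop Φ hfs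
  have hg := measurable_green (P₀ := P₀) hm
  have hg1 : ∀ x, green P₀ (kop Φ (f ∘ some)) x ≤ 1 :=
    green_le_one h.split hm (h.kop_mark_le hf1)
  have hΨ : ∀ s, kop Ψ (green P₀ (kop Φ (f ∘ some))) s ≤ f (some s) := fun s =>
    (h.kop_le s f hf).trans (hs _)
  have hJ : ∀ x, kop J (green P₀ (kop Φ (f ∘ some))) x ≤ kop Φ (f ∘ some) x := fun x => by
    rw [h.kop_J hg]
    exact kop_mono Φ hΨ x
  have hsup : ∀ x, kop P (green P₀ (kop Φ (f ∘ some))) x ≤ green P₀ (kop Φ (f ∘ some)) x := by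
    intro x
    rw [kop_add_apply h.split, green_eq hm x, add_comm]
    gcongr
    exact hJ x
  refine (Measure.ae_comp_iff (measurableSet_eq_fun
    ((measurable_kop Q hf).comp measurable_some) (hf.comp measurable_some))).2 ?_
  filter_upwards [hμ.kop_eq_of_le hg hg1 (Eventually.of_forall hsup)] with x hx
  have hfin : kop P₀ (green P₀ (kop Φ (f ∘ some))) x ≠ ⊤ := by
    refine ne_top_of_le_ne_top ENNReal.one_ne_top (le_trans ?_ (hg1 x))
    rw [green_eq hm x]
    exact le_add_self
  rw [kop_add_apply h.split, green_eq hm x, add_comm, ENNReal.add_left_inj hfin, h.kop_J hg] at hx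
  have hfin2 : kop Φ (f ∘ some) x ≠ ⊤ := by
    refine ne_top_of_le_ne_top ENNReal.one_ne_top (le_trans ?_ (hg1 x))
    rw [green_eq hm x]
    exact le_self_add
  have := ae_eq_of_ae_le_of_lintegral_le (μ := Φ x) (Eventually.of_forall hΨ)
    (by change kop Φ _ x ≠ ⊤; rwa [hx]) hfs.aemeasurable
    (by change kop Φ (f ∘ some) x ≤ kop Φ _ x; rw [hx])
  filter_upwards [this] with s hs'
  exact le_antisymm (hs _) (hs'.symm.le.trans (h.kop_le s f hf))

/-- The measure marked by a recurrent measure is recurrent for the induced chain. -/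
lemma isRecurrent (h : IsInduced P P₀ J Φ Ψ Q μ)
    (hμ : IsRecurrent P μ) [IsMarkovKernel Q] [SigmaFinite (μ.bind Φ)] :
    IsRecurrent Q (extendMeasure (μ.bind Φ)) := by
  have : SigmaFinite (extendMeasure (μ.bind Φ)) := measurableEmbedding_some.sigmaFinite_map
  refine isRecurrent_of_excessive (h.bind_le hμ.1) fun B hB _ => ?_
  -- The superharmonic function is the probability of ever visiting `B`, time 0 included: it is 1 on
  -- `B`, and its average over one step is the probability of a return.
  have hf : Measurable fun o => law Q o {y | ∃ n, y n ∈ B} :=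
    (law Q).measurable_coe (measurableSet_exists_mem hB)
  have hle : ∀ o, kop Q (fun o => law Q o {y | ∃ n, y n ∈ B}) o ≤
      law Q o {y | ∃ n, y n ∈ B} := fun o => by
    rw [kop_law_exists_mem hB]
    exact measure_mono fun y hy => (hitTime_lt_top_iff.1 hy).imp' (· + 1) fun n hn => hn
  rw [ae_extendMeasure_iff]
  filter_upwards [h.kop_eq_of_superharmonic hμ hf (fun o => prob_le_one) hle] with s hs hsB
  rw [kop_law_exists_mem hB] at hs
  rw [hs, ← prob_compl_eq_zero_iff (measurableSet_exists_mem hB), measure_eq_zero_iff_ae_notMem]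
  filter_upwards [(ae_law_zero Q hB).2 hsB] with y hy
  exact not_not.2 ⟨0, hy⟩

/-- The measure marked by an irreducible recurrent measure is irreducible for the induced chain. -/
lemma isIrreducibleMeasure (h : IsInduced P P₀ J Φ Ψ Q μ)
    (hμ : IsRecurrent P μ) (hirr : IsIrreducibleMeasure P μ)
    (hinv : Q.Invariant (extendMeasure (μ.bind Φ))) :
    IsIrreducibleMeasure Q (extendMeasure (μ.bind Φ)) := by
  refine ⟨hinv, fun B hB hBinv => ?_⟩
  have hf : Measurable (B.indicator (1 : Option S → ℝ≥0∞)) := measurable_one.indicator hB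
  set f : Option S → ℝ≥0∞ := B.indicator 1 with hfdef
  have hf1 : ∀ o, f o ≤ 1 := fun o => Set.indicator_le_self' (by simp) o
  have hm : Measurable (kop Φ (f ∘ some)) := measurable_kop Φ (hf.comp measurable_some)
  have hg := measurable_green (P₀ := P₀) hm
  set g := green P₀ (kop Φ (f ∘ some)) with hgdef
  have hg1 : ∀ x, g x ≤ 1 := green_le_one h.split hm (h.kop_mark_le hf1)
  have hΨ : ∀ᵐ s ∂(μ.bind Φ), kop Ψ g s = f (some s) := by
    filter_upwards [h.kop_eq, ae_extendMeasure_iff.1 hBinv] with s hs hs2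
    rw [hs f hf, kop_indicator Q hB, hs2]
  have hharm : ∀ᵐ x ∂μ, kop P g x ≤ g x := by
    filter_upwards [Measure.ae_ae_of_ae_comp hΨ] with x hx
    rw [kop_add_apply h.split, h.kop_J hg, kop_congr_ae hx, hgdef, green_eq hm x, add_comm]
    rfl
  obtain ⟨c, hc⟩ := hirr.exists_ae_eq_const hg (hμ.ae_eq_of_le hg hg1 hharm)
  -- `μ`-almost all steps of `P` land where `g = c`; so do the steps of `J ≤ P`, which decompose
  -- through `S`.
  have hΨc : ∀ᵐ s ∂(μ.bind Φ), ∀ᵐ z ∂Ψ s, g z = c := by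
    have hset : MeasurableSet {z | g z = c} := hg (measurableSet_singleton c)
    refine (Measure.ae_comp_iff ?_).2 ?_
    · exact measurableSet_eq_fun (Ψ.measurable_coe hset.compl) measurable_const
    · filter_upwards [ae_ae_of_invariant hμ.1 hc] with x hx
      have hJP : J x ≤ P x := by
        rw [h.split, add_apply]
        exact Measure.le_add_left le_rfl
      have hxJ := ae_mono hJP hx
      rw [← h.comp] at hxJ
      exact Kernel.ae_ae_of_ae_comp hxJ
  have hfc : ∀ᵐ s ∂(μ.bind Φ), f (some s) = c := by
    filter_upwards [hΨ, hΨc, h.mass_eq_one] with s h1 h2 h3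
    rw [← h1, kop_congr_ae (g := fun _ => c) h2, kop, lintegral_const, h3, mul_one]
  by_cases hc1 : c = 1
  · refine Or.inr (measure_eq_zero_iff_ae_notMem.2 (ae_extendMeasure_iff.2 ?_))
    filter_upwards [hfc] with s hs hsB
    rw [hfdef, Set.indicator_of_notMem hsB] at hs
    exact zero_ne_one (hs.trans hc1)
  · refine Or.inl (measure_eq_zero_iff_ae_notMem.2 (ae_extendMeasure_iff.2 ?_))
    filter_upwards [hfc] with s hs hsB
    rw [hfdef, Set.indicator_of_mem hsB] at hs
    exact hc1 hs.symm

/-- Kac's formula, when almost every point reaches the marked set. -/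
lemma lintegral_kop_green_indicator (h : IsInduced P P₀ J Φ Ψ Q μ)
    (hμ : IsRecurrent P μ) [IsMarkovKernel Q] [SigmaFinite (μ.bind Φ)]
    (hone : ∀ᵐ x ∂μ, green P₀ (fun x => Φ x Set.univ) x = 1) {B : Set X} (hB : MeasurableSet B) :
    ∫⁻ x, kop J (green P₀ (B.indicator 1)) x ∂μ = μ B := by
  set ν := μ.bind Φ with hν
  have hinv := (h.isRecurrent hμ).1
  set σ := spanningSets ν with hσ
  have hσm : ∀ n, MeasurableSet (σ n) := measurableSet_spanningSets ν
  set φ : ℕ → X → ℝ≥0∞ := fun j x => Φ x (σ j) with hφ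
  have hφm : ∀ j, Measurable (φ j) := fun j => Φ.measurable_coe (hσm j)
  -- Invariance of the marked measure makes the telescoping bound an equality for `φ j`, whose
  -- integral is finite; hence no remainder survives.
  have hlim : ∀ j, Tendsto (fun n => ∫⁻ x, (kop P₀)^[n] (φ j) x ∂μ) atTop (nhds 0) := by
    intro j
    have hint : ∫⁻ x, φ j x ∂μ = ν (σ j) :=
      (Measure.bind_apply (hσm j) Φ.aemeasurable).symm
    refine tendsto_lintegral_iterate_zero h.split hμ.1 (hφm j)
      (hint ▸ (measure_spanningSets_lt_top ν j).ne) ?_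
    have hB' : MeasurableSet (some '' σ j : Set (Option S)) :=
      measurableEmbedding_some.measurableSet_image.2 (hσm j)
    have hpre : some ⁻¹' (some '' σ j : Set (Option S)) = σ j :=
      Set.preimage_image_eq _ (Option.some_injective S)
    have hf : Measurable ((some '' σ j : Set (Option S)).indicator (1 : Option S → ℝ≥0∞)) :=
      measurable_one.indicator hB'
    have e := h.lintegral_kop_extend hf
    have e2 : kop Φ ((some '' σ j : Set (Option S)).indicator (1 : Option S → ℝ≥0∞) ∘ some) =
        φ j := by
      funext x
      have : (some '' σ j : Set (Option S)).indicator (1 : Option S → ℝ≥0∞) ∘ some =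
          (σ j).indicator 1 := by
        conv_rhs => rw [← hpre]
        funext s
        exact (Set.indicator_comp_right (g := (1 : Option S → ℝ≥0∞)) some).symm
      rw [this, kop_indicator Φ (hσm j)]
    rw [e2, lintegral_kop_of_invariant hinv hf, lintegral_indicator_one hB', extendMeasure,
      Measure.map_apply measurable_some hB', hpre] at e
    rw [← e, hint]
  set u : ℕ → X → ℝ≥0∞ := fun j x => ∑ k ∈ Finset.range j, (kop P₀)^[k] (φ j) x with hu
  have hum : ∀ j, Measurable (u j) := fun j =>
    Finset.measurable_sum _ fun k _ => kop_iterate_measurable P₀ (hφm j) k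
  have hulim : ∀ j, Tendsto (fun n => ∫⁻ x, (kop P₀)^[n] (u j) x ∂μ) atTop (nhds 0) := by
    intro j
    have e : ∀ n x, (kop P₀)^[n] (u j) x =
        ∑ k ∈ Finset.range j, (kop P₀)^[n + k] (φ j) x := by
      intro n
      induction n with
      | zero => intro x; simp [hu]
      | succ n ih =>
        intro x
        rw [Function.iterate_succ_apply', funext ih,
          kop_sum P₀ fun k => kop_iterate_measurable P₀ (hφm j) (n + k)]
        refine Finset.sum_congr rfl fun k _ => ?_
        rw [← Function.iterate_succ_apply' (kop P₀)]
        rw [Nat.succ_add]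
    have e2 : ∀ n, ∫⁻ x, (kop P₀)^[n] (u j) x ∂μ =
        ∑ k ∈ Finset.range j, ∫⁻ x, (kop P₀)^[n + k] (φ j) x ∂μ := fun n => by
      rw [lintegral_congr (e n),
        lintegral_finsetSum _ fun k _ => kop_iterate_measurable P₀ (hφm j) _]
    simp only [e2]
    have : Tendsto (fun n => ∑ k ∈ Finset.range j, ∫⁻ x, (kop P₀)^[n + k] (φ j) x ∂μ) atTop
        (nhds (∑ k ∈ Finset.range j, 0)) :=
      tendsto_finsetSum _ fun k _ => (hlim j).comp (tendsto_add_atTop_nat k)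
    simpa using this
  -- The `u j` increase to the potential of the full mark, which is 1 almost everywhere by `hone`.
  -- The `V j` therefore exhaust the space; any positive threshold below 1 would serve.
  set V : ℕ → Set X := fun j => {x | 2⁻¹ ≤ u j x} with hV
  have hVm : ∀ j, MeasurableSet (V j) := fun j => measurableSet_le measurable_const (hum j)
  have humono : ∀ x, Monotone fun j => u j x := by
    intro x i j hij
    refine (Finset.sum_le_sum_of_subset (Finset.range_mono hij)).trans
      (Finset.sum_le_sum fun k _ => ?_)
    exact kop_iterate_mono P₀ (fun z => measure_mono (monotone_spanningSets ν hij)) k x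
  have hVmono : Monotone V := fun i j hij x hx => le_trans hx (humono x hij)
  have hVall : ∀ᵐ x ∂μ, ∃ j, x ∈ V j := by
    filter_upwards [hone] with x hx
    have hsup : green P₀ (fun x => Φ x Set.univ) x ≤ ⨆ j, u j x := by
      rw [green, ENNReal.tsum_eq_iSup_nat]
      refine iSup_le fun n => ?_
      have hk : ∀ k x, (kop P₀)^[k] (fun x => Φ x Set.univ) x = ⨆ j, (kop P₀)^[k] (φ j) x := by
        intro k
        induction k with
        | zero =>
          intro x
          simp only [Function.iterate_zero, id, hφ]
          rw [← iUnion_spanningSets ν, (monotone_spanningSets ν).measure_iUnion]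
        | succ k ih =>
          intro x
          simp only [Function.iterate_succ_apply']
          rw [funext ih]
          exact lintegral_iSup (fun j => kop_iterate_measurable P₀ (hφm j) k)
            fun i j hij z => kop_iterate_mono P₀
              (fun z => measure_mono (monotone_spanningSets ν hij)) k z
      simp only [hk]
      rw [ENNReal.finsetSum_iSup_of_monotone (f := fun k j => (kop P₀)^[k] (φ j) x)
            fun k i j hij => kop_iterate_mono P₀
              (fun z => measure_mono (monotone_spanningSets ν hij)) k x]
      -- The index of `u` bounds both the number of terms and the spanning set, hence the maximum.
      refine iSup_le fun j => le_trans ?_ (le_iSup (fun j => u j x) (max n j))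
      refine (Finset.sum_le_sum_of_subset (Finset.range_mono (le_max_left n j))).trans
        (Finset.sum_le_sum fun k _ => ?_)
      exact kop_iterate_mono P₀
        (fun z => measure_mono (monotone_spanningSets ν (le_max_right n j))) k x
    rw [hx] at hsup
    have : (2⁻¹ : ℝ≥0∞) < ⨆ j, u j x := lt_of_lt_of_le (by simp) hsup
    obtain ⟨j, hj⟩ := lt_iSup_iff.1 this
    exact ⟨j, hj.le⟩
  have hkac : ∀ j, ∫⁻ x, kop J (green P₀ ((B ∩ V j).indicator 1)) x ∂μ = μ (B ∩ V j) := by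
    intro j
    have hBm : MeasurableSet (B ∩ V j) := hB.inter (hVm j)
    have hone' : Measurable ((B ∩ V j).indicator (1 : X → ℝ≥0∞)) := measurable_one.indicator hBm
    rw [lintegral_kop_green_eq_of_tendsto h.split hμ.1 hone', lintegral_indicator_one hBm]
    -- Domination by `2 * u j` transfers the vanishing remainder to the indicator of `B ∩ V j`, even
    -- if this set has infinite measure.
    have hle : ∀ x, (B ∩ V j).indicator (1 : X → ℝ≥0∞) x ≤ 2 * u j x := by
      intro x
      by_cases hx : x ∈ B ∩ V j
      · rw [Set.indicator_of_mem hx, Pi.one_apply,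
          ← ENNReal.mul_inv_cancel (a := 2) (by simp) (by simp)]
        gcongr
        exact hx.2
      · simp [Set.indicator_of_notMem hx]
    have hmul : ∀ n x, (kop P₀)^[n] (fun x => 2 * u j x) x = 2 * (kop P₀)^[n] (u j) x := by
      intro n
      induction n with
      | zero => simp
      | succ n ih =>
        intro x
        rw [Function.iterate_succ_apply', funext ih, Function.iterate_succ_apply']
        exact lintegral_const_mul _ (kop_iterate_measurable P₀ (hum j) n)
    refine tendsto_of_tendsto_of_tendsto_of_le_of_le tendsto_const_nhds
      (h := fun n => 2 * ∫⁻ x, (kop P₀)^[n] (u j) x ∂μ) ?_ (fun n => zero_le) fun n => ?_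
    · simpa using ENNReal.Tendsto.const_mul (a := 2) (hulim j) (Or.inr (by simp))
    · beta_reduce
      rw [← lintegral_const_mul _ (kop_iterate_measurable P₀ (hum j) n)]
      exact lintegral_mono fun x => (kop_iterate_mono P₀ hle n x).trans (hmul n x).le
  have hone' : Measurable (B.indicator (1 : X → ℝ≥0∞)) := measurable_one.indicator hB
  refine le_antisymm ((lintegral_kop_green_le h.split hμ.1 hone').trans
    (lintegral_indicator_one hB).le) ?_
  have hμB : μ B = μ (⋃ j, B ∩ V j) := by
    refine measure_congr ?_
    filter_upwards [hVall] with x ⟨j, hj⟩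
    exact propext ⟨fun hx => Set.mem_iUnion.2 ⟨j, hx, hj⟩,
      fun hx => (Set.mem_iUnion.1 hx).elim fun _ hx => hx.1⟩
  have hmon : Monotone fun j => B ∩ V j := fun i j hij =>
    Set.inter_subset_inter_right _ (hVmono hij)
  rw [hμB, hmon.measure_iUnion]
  refine iSup_le fun j => (hkac j).symm.le.trans (lintegral_mono fun x => ?_)
  refine kop_mono J (fun z => green_mono (fun w => ?_) z) x
  exact Set.indicator_le_indicator_of_subset Set.inter_subset_left (fun _ => zero_le) w

end IsInduced

end Trace

/-! ### Combinatorics of entrance times -/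

section EntersAt

variable {X : Type*} {A : Set X}

lemma not_entersAt_zero (y : ℕ → X) : ¬ EntersAt A y 0 := fun h => by simpa using h.1

lemma entersAt_succ_iff {y : ℕ → X} {k : ℕ} : EntersAt A y (k + 1) ↔ y k ∈ Aᶜ ∧ y (k + 1) ∈ A := by
  simp [EntersAt]

/-- Prepending a point delays every entrance by one and can create only one new entrance, at time 1.
-/
lemma entersAt_prepend_iff {x : X} {y : ℕ → X} {k : ℕ} :
    EntersAt A (prepend x y) (k + 1) ↔ (k = 0 ∧ x ∈ Aᶜ ∧ y 0 ∈ A) ∨ EntersAt A y k := by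
  cases k with
  | zero => simp [entersAt_succ_iff, not_entersAt_zero]
  | succ k => simp [entersAt_succ_iff]

lemma exists_entersAt_prepend_iff {x : X} {y : ℕ → X} (n : ℕ) :
    (∃ k ≤ n + 1, EntersAt A (prepend x y) k) ↔
      (x ∈ Aᶜ ∧ y 0 ∈ A) ∨ ∃ k ≤ n, EntersAt A y k := by
  constructor
  · rintro ⟨_ | k, hk, h⟩
    · exact (not_entersAt_zero _ h).elim
    · rcases entersAt_prepend_iff.1 h with h | h
      exacts [Or.inl h.2, Or.inr ⟨k, by omega, h⟩]
  · rintro (h | ⟨k, hk, h⟩)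
    exacts [⟨1, by omega, entersAt_prepend_iff.2 (Or.inl ⟨rfl, h⟩)⟩,
      ⟨k + 1, by omega, entersAt_prepend_iff.2 (Or.inr h)⟩]

lemma exists_entersAt_of_le {y : ℕ → X} {n m : ℕ} (hnm : n ≤ m) (hn : y n ∈ Aᶜ) (hm : y m ∈ A) :
    ∃ k, EntersAt A y k := by
  induction m, hnm using Nat.le_induction with
  | base => exact (hn hm).elim
  | succ m _ ih =>
    by_cases h : y m ∈ A
    · exact ih h
    · exact ⟨m + 1, entersAt_succ_iff.2 ⟨h, hm⟩⟩

lemma entrancePos_eq_some {y : ℕ → X} {k : ℕ} (hk : EntersAt A y k)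
    (hmin : ∀ j < k, ¬ EntersAt A y j) : entrancePos A y = some ⟨y k, hk.2.2⟩ := by
  classical
  have h : ∃ k, EntersAt A y k := ⟨k, hk⟩
  have hf : Nat.find h = k := (Nat.find_eq_iff h).2 ⟨hk, hmin⟩
  rw [entrancePos, dif_pos h]
  congr 2
  exact congrArg y hf

lemma exitPos_eq_some {y : ℕ → X} {k : ℕ} (hk : EntersAt A y k)
    (hmin : ∀ j < k, ¬ EntersAt A y j) : exitPos A y = some ⟨y (k - 1), hk.2.1⟩ := by
  classical
  have h : ∃ k, EntersAt A y k := ⟨k, hk⟩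
  have hf : Nat.find h = k := (Nat.find_eq_iff h).2 ⟨hk, hmin⟩
  rw [exitPos, dif_pos h]
  congr 2
  exact congrArg (fun k => y (k - 1)) hf

lemma exists_first_entersAt {y : ℕ → X} (h : ∃ k, EntersAt A y k) :
    ∃ k, EntersAt A y k ∧ ∀ j < k, ¬ EntersAt A y j := by
  classical
  exact ⟨Nat.find h, Nat.find_spec h, fun j hj => Nat.find_min h hj⟩

lemma pos_prepend_of_crossing {x : X} {y : ℕ → X} (hx : x ∈ Aᶜ) (hy : y 0 ∈ A) :
    entrancePos A (prepend x y) = some ⟨y 0, hy⟩ ∧ exitPos A (prepend x y) = some ⟨x, hx⟩ := by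
  have h1 : EntersAt A (prepend x y) 1 := entersAt_prepend_iff.2 (Or.inl ⟨rfl, hx, hy⟩)
  have hmin : ∀ j < 1, ¬ EntersAt A (prepend x y) j := fun j hj => by
    obtain rfl : j = 0 := by omega
    exact not_entersAt_zero _
  exact ⟨entrancePos_eq_some h1 hmin, exitPos_eq_some h1 hmin⟩

lemma pos_prepend_of_not_crossing {x : X} {y : ℕ → X} (h : ¬ (x ∈ Aᶜ ∧ y 0 ∈ A)) :
    entrancePos A (prepend x y) = entrancePos A y ∧ exitPos A (prepend x y) = exitPos A y := by
  have hiff : ∀ k, EntersAt A (prepend x y) (k + 1) ↔ EntersAt A y k := fun k => by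
    rw [entersAt_prepend_iff]
    exact or_iff_right fun hk => h hk.2
  by_cases hex : ∃ k, EntersAt A y k
  · obtain ⟨k, hk, hmin⟩ := exists_first_entersAt hex
    have hmin' : ∀ j < k + 1, ¬ EntersAt A (prepend x y) j := by
      rintro (_ | j) hj
      exacts [not_entersAt_zero _, fun h => hmin j (by omega) ((hiff j).1 h)]
    obtain ⟨k, rfl⟩ : ∃ m, k = m + 1 :=
      Nat.exists_eq_succ_of_ne_zero fun h0 => not_entersAt_zero y (h0 ▸ hk)
    rw [entrancePos_eq_some hk hmin, entrancePos_eq_some ((hiff _).2 hk) hmin',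
      exitPos_eq_some hk hmin, exitPos_eq_some ((hiff _).2 hk) hmin']
    exact ⟨rfl, rfl⟩
  · have hex' : ¬ ∃ k, EntersAt A (prepend x y) k := by
      rintro ⟨_ | k, hk⟩
      exacts [not_entersAt_zero _ hk, hex ⟨k, (hiff k).1 hk⟩]
    simp only [entrancePos, exitPos, dif_neg hex, dif_neg hex', and_self]

lemma lt_entranceTime_iff {y : ℕ → X} {k : ℕ} :
    (k : ℕ∞) < entranceTime A y ↔ ∀ j ≤ k, ¬ EntersAt A y j := by
  constructor
  · intro h j hj hE
    have : entranceTime A y ≤ j := iInf₂_le j hE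
    exact absurd (h.trans_le this) (by simpa using hj)
  · intro h
    refine lt_of_lt_of_le (b := ((k + 1 : ℕ) : ℕ∞)) (by exact_mod_cast Nat.lt_succ_self k) ?_
    refine le_iInf₂ fun j hE => ?_
    by_contra hlt
    exact h j (by have : j < k + 1 := by exact_mod_cast not_le.1 hlt
                  omega) hE

end EntersAt

/-! ### Splitting the kernel at the jumps from the complement to the set -/

section EnterStay

variable {X : Type*} [MeasurableSpace X] {A : Set X}

/-- The part of the transition kernel that corresponds to the jumps from `Aᶜ` to `A`. -/
def enterKernel (P : Kernel X X) (hA : MeasurableSet A) : Kernel X X :=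
  open Classical in Kernel.piecewise hA 0 (P.restrict hA)

/-- The part of the transition kernel that corresponds to the jumps not from `Aᶜ` to `A`. -/
def stayKernel (P : Kernel X X) (hA : MeasurableSet A) : Kernel X X :=
  open Classical in Kernel.piecewise hA P (P.restrict hA.compl)

variable (P : Kernel X X) (hA : MeasurableSet A)

lemma enterKernel_of_mem {x : X} (hx : x ∈ A) : enterKernel P hA x = 0 := by
  simp [enterKernel, Kernel.piecewise_apply, hx]

lemma enterKernel_of_notMem {x : X} (hx : x ∉ A) : enterKernel P hA x = (P x).restrict A := by
  simp [enterKernel, Kernel.piecewise_apply, hx, Kernel.restrict_apply]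

lemma stayKernel_of_mem {x : X} (hx : x ∈ A) : stayKernel P hA x = P x := by
  simp [stayKernel, Kernel.piecewise_apply, hx]

lemma stayKernel_of_notMem {x : X} (hx : x ∉ A) : stayKernel P hA x = (P x).restrict Aᶜ := by
  simp [stayKernel, Kernel.piecewise_apply, hx, Kernel.restrict_apply]

lemma stayKernel_add_enterKernel : P = stayKernel P hA + enterKernel P hA := by
  ext1 x
  rw [add_apply]
  by_cases hx : x ∈ A
  · rw [stayKernel_of_mem P hA hx, enterKernel_of_mem P hA hx, add_zero]
  · rw [stayKernel_of_notMem P hA hx, enterKernel_of_notMem P hA hx, add_comm,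
      Measure.restrict_add_restrict_compl hA]

lemma enterKernel_restrict (x : X) : (enterKernel P hA x).restrict A = enterKernel P hA x := by
  by_cases hx : x ∈ A
  · simp [enterKernel_of_mem P hA hx]
  · simp [enterKernel_of_notMem P hA hx, Measure.restrict_restrict hA]

lemma bind_enterKernel (μ : Measure X) :
    μ.bind (enterKernel P hA) = ((μ.restrict Aᶜ).bind P).restrict A := by
  ext B hB
  rw [Measure.bind_apply hB (Kernel.aemeasurable _), Measure.restrict_apply hB,
    Measure.bind_apply (hB.inter hA) (Kernel.aemeasurable _), ← lintegral_indicator hA.compl]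
  refine lintegral_congr fun x => ?_
  by_cases hx : x ∈ A
  · simp [enterKernel_of_mem P hA hx, hx]
  · rw [enterKernel_of_notMem P hA hx, Set.indicator_of_mem (by exact hx),
      Measure.restrict_apply hB]

-- From `x ∈ A` every step is a stay; from `x ∉ A` the two kernels are the restrictions of `P x` to
-- `A` and to `Aᶜ`.
open Classical in
lemma lintegral_ite_crossing {a b : X → ℝ≥0∞} (x : X) :
    ∫⁻ z, (if x ∈ Aᶜ ∧ z ∈ A then a z else b z) ∂P x =
      kop (enterKernel P hA) a x + kop (stayKernel P hA) b x := by
  by_cases hx : x ∈ A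
  · simp [kop, enterKernel_of_mem P hA hx, stayKernel_of_mem P hA hx, hx]
  · rw [kop, kop, enterKernel_of_notMem P hA hx, stayKernel_of_notMem P hA hx,
      ← lintegral_add_compl _ hA]
    congr 1
    · exact setLIntegral_congr_fun hA fun z hz => if_pos ⟨hx, hz⟩
    · exact setLIntegral_congr_fun hA.compl fun z hz => if_neg fun h => hz h.2

variable [IsMarkovKernel P]

open Classical in
/-- The part of the trajectory before the first entrance, in terms of iterates of `stayKernel`. -/
lemma lintegral_law_before_entrance {g : X → ℝ≥0∞} (hg : Measurable g) (k : ℕ) (x : X) :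
    ∫⁻ y, (if ∀ j ≤ k, ¬ EntersAt A y j then g (y k) else 0) ∂law P x =
      (kop (stayKernel P hA))^[k] g x := by
  have hmeas : ∀ k, MeasurableSet {y : ℕ → X | ∀ j ≤ k, ¬ EntersAt A y j} := fun k => by
    simp only [Set.ofPred_forall]
    exact MeasurableSet.iInter fun j => MeasurableSet.iInter fun _ =>
      (measurableSet_entersAt hA j).compl
  have hF : ∀ k, Measurable fun y : ℕ → X => if ∀ j ≤ k, ¬ EntersAt A y j then g (y k) else 0 :=
    fun k => Measurable.ite (hmeas k) (hg.comp (measurable_coord k)) measurable_const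
  induction k generalizing x with
  | zero =>
    refine (lintegral_congr fun y => if_pos fun j hj => ?_).trans (lintegral_law_coord P hg 0 x)
    obtain rfl : j = 0 := by omega
    exact not_entersAt_zero y
  | succ k ih =>
    rw [lintegral_law P x (hF (k + 1)), Function.iterate_succ_apply']
    have hsplit := lintegral_ite_crossing P hA (a := fun _ => 0)
      (b := (kop (stayKernel P hA))^[k] g) x
    have h0 : kop (enterKernel P hA) (fun _ => 0) x = 0 := by simp [kop]
    rw [h0, zero_add] at hsplit
    rw [← hsplit]
    refine lintegral_congr fun z => ?_
    rw [← ih z]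
    -- The condition on the first step involves `y 0`; separating it as a variable `a` lets
    -- `lintegral_law_zero` replace it by `z`.
    have hm : Measurable (Function.uncurry fun (a : X) (y : ℕ → X) =>
        if x ∈ Aᶜ ∧ a ∈ A then 0 else (if ∀ j ≤ k, ¬ EntersAt A y j then g (y k) else 0)) :=
      Measurable.ite (measurable_fst ((MeasurableSet.const (x ∈ Aᶜ)).inter hA)) measurable_const
        ((hF k).comp measurable_snd)
    have hz := lintegral_law_zero P z hm
    have e : ∀ y : ℕ → X, (if ∀ j ≤ k + 1, ¬ EntersAt A (prepend x y) j then
        g (prepend x y (k + 1)) else 0) = if x ∈ Aᶜ ∧ y 0 ∈ A then 0 else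
          (if ∀ j ≤ k, ¬ EntersAt A y j then g (y k) else 0) := by
      intro y
      have := not_congr (exists_entersAt_prepend_iff (A := A) (x := x) (y := y) k)
      push Not at this
      by_cases hC : x ∈ Aᶜ ∧ y 0 ∈ A
      · rw [if_pos hC, if_neg fun h => (this.1 h).1 hC.1 hC.2]
      · rw [if_neg hC]
        refine if_congr (this.trans (and_iff_right ?_)) rfl rfl
        simpa using hC
    simp only [e]
    rw [hz]
    by_cases hC : x ∈ Aᶜ ∧ z ∈ A
    · simp only [if_pos hC, lintegral_zero]
    · simp only [if_neg hC]

open Classical in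
/-- The expectation of a functional of the first entrance, in terms of the potential of
`stayKernel`. -/
lemma lintegral_law_entrance {R : (ℕ → X) → ℝ≥0∞} (hR : Measurable R) {r : X → X → ℝ≥0∞}
    (hr : ∀ x, Measurable (r x))
    (hRr : ∀ x y, R (prepend x y) = if x ∈ Aᶜ ∧ y 0 ∈ A then r x (y 0) else R y)
    (hφ : Measurable fun x => kop (enterKernel P hA) (r x) x) (x : X) :
    ∫⁻ y, {y | ∃ k, EntersAt A y k}.indicator R y ∂law P x =
      green (stayKernel P hA) (fun x => kop (enterKernel P hA) (r x) x) x := by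
  -- Restricting to entrances up to time `n` yields the partial sums of the potential by one-step
  -- recursion; monotone convergence then gives the whole potential.
  set E : ℕ → Set (ℕ → X) := fun n => {y | ∃ k ≤ n, EntersAt A y k} with hE
  have hEm : ∀ n, MeasurableSet (E n) := fun n => by
    simp only [hE, Set.ofPred_exists]
    exact MeasurableSet.iUnion fun k =>
      (MeasurableSet.const (k ≤ n)).inter (measurableSet_entersAt hA k)
  have hF : ∀ n, Measurable ((E n).indicator R) := fun n => hR.indicator (hEm n)
  have hsum : ∀ n x, ∫⁻ y, (E n).indicator R y ∂law P x = ∑ k ∈ Finset.range n,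
      (kop (stayKernel P hA))^[k] (fun x => kop (enterKernel P hA) (r x) x) x := by
    intro n
    induction n with
    | zero =>
      intro x
      have : E 0 = ∅ := by
        ext y
        simp only [hE, Set.mem_ofPred_eq, Set.mem_empty_iff_false, iff_false]
        rintro ⟨k, hk, h⟩
        obtain rfl : k = 0 := by omega
        exact not_entersAt_zero y h
      simp [this]
    | succ n ih =>
      intro x
      rw [lintegral_law P x (hF (n + 1)), Finset.sum_range_succ']
      simp only [Function.iterate_succ_apply', Function.iterate_zero, id]
      rw [← kop_sum _ fun k => kop_iterate_measurable _ hφ k,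
        add_comm _ (kop (enterKernel P hA) (r x) x),
        ← funext (ih ·),
        ← lintegral_ite_crossing P hA]
      refine lintegral_congr fun z => ?_
      have hm : Measurable (Function.uncurry fun (a : X) (y : ℕ → X) =>
          if x ∈ Aᶜ ∧ a ∈ A then r x a else (E n).indicator R y) :=
        Measurable.ite (measurable_fst ((MeasurableSet.const (x ∈ Aᶜ)).inter hA))
          ((hr x).comp measurable_fst) ((hF n).comp measurable_snd)
      have hz := lintegral_law_zero P z hm
      have e : ∀ y : ℕ → X, (E (n + 1)).indicator R (prepend x y) =
          if x ∈ Aᶜ ∧ y 0 ∈ A then r x (y 0) else (E n).indicator R y := by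
        intro y
        have := exists_entersAt_prepend_iff (A := A) (x := x) (y := y) n
        by_cases hC : x ∈ Aᶜ ∧ y 0 ∈ A
        · rw [if_pos hC, Set.indicator_of_mem (show prepend x y ∈ E (n + 1) from
            this.2 (Or.inl hC)), hRr, if_pos hC]
        · rw [if_neg hC]
          by_cases hy : y ∈ E n
          · rw [Set.indicator_of_mem hy, Set.indicator_of_mem (show prepend x y ∈ E (n + 1) from
              this.2 (Or.inr hy)), hRr, if_neg hC]
          · rw [Set.indicator_of_notMem hy, Set.indicator_of_notMem]
            exact fun h => (this.1 h).elim hC hy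
      simp only [e]
      rw [hz]
      by_cases hC : x ∈ Aᶜ ∧ z ∈ A
      · simp only [if_pos hC, lintegral_const, measure_univ, mul_one]
      · simp only [if_neg hC]
  have hEmono : Monotone E := fun i j hij y ⟨k, hk, h⟩ => ⟨k, hk.trans hij, h⟩
  have hsup : ∀ y, {y | ∃ k, EntersAt A y k}.indicator R y = ⨆ n, (E n).indicator R y := by
    intro y
    have hU : {y : ℕ → X | ∃ k, EntersAt A y k} = ⋃ n, E n := by
      ext y
      simp only [Set.mem_iUnion]
      exact ⟨fun ⟨k, h⟩ => ⟨k, k, le_rfl, h⟩, fun ⟨_, k, _, h⟩ => ⟨k, h⟩⟩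
    rw [hU, Set.indicator_iUnion_apply rfl]
  simp only [hsup]
  rw [lintegral_iSup hF fun i j hij y =>
    Set.indicator_le_indicator_of_subset (hEmono hij) (fun _ => zero_le) y, green,
    ENNReal.tsum_eq_iSup_nat]
  simp only [hsum]

end EnterStay

/-! ### Paths that cross infinitely often -/

section Crossing

variable {X : Type*} {A : Set X}

lemma frequently_shift_iff {B : Set X} {y : ℕ → X} :
    (∃ᶠ n in atTop, shift y n ∈ B) ↔ ∃ᶠ n in atTop, y n ∈ B := by
  have : (∃ᶠ n in map (fun n => n + 1) atTop, y n ∈ B) ↔ ∃ᶠ n in atTop, shift y n ∈ B :=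
    frequently_map
  rw [← this, map_add_atTop_eq_nat]

/-- The sequences that visit both `A` and `Aᶜ` infinitely often. -/
def crossingPaths (A : Set X) : Set (ℕ → X) :=
  {y | (∃ᶠ k in atTop, y k ∈ A) ∧ (∃ᶠ k in atTop, y k ∈ Aᶜ)}

lemma shift_mem_crossingPaths_iff {y : ℕ → X} :
    shift y ∈ crossingPaths A ↔ y ∈ crossingPaths A :=
  and_congr frequently_shift_iff frequently_shift_iff

lemma exists_entersAt_of_mem_crossingPaths {y : ℕ → X} (hy : y ∈ crossingPaths A) :
    ∃ k, EntersAt A y k := by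
  obtain ⟨n, hn⟩ := hy.2.exists
  obtain ⟨m, hm, hmA⟩ := frequently_atTop.1 hy.1 n
  exact exists_entersAt_of_le hm hn hmA

variable [MeasurableSpace X] {P : Kernel X X} [IsMarkovKernel P] {μ : Measure X}

lemma measurableSet_crossingPaths (hA : MeasurableSet A) : MeasurableSet (crossingPaths A) :=
  (measurableSet_frequently_mem hA).inter (measurableSet_frequently_mem hA.compl)

lemma measurableSet_crossingSet (hA : MeasurableSet A) : MeasurableSet (crossingSet P A) :=
  measurableSet_eq_fun ((law P).measurable_coe (measurableSet_crossingPaths hA)) measurable_const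

lemma mem_crossingSet_iff (hA : MeasurableSet A) {x : X} :
    x ∈ crossingSet P A ↔ ∀ᵐ y ∂law P x, y ∈ crossingPaths A :=
  (prob_compl_eq_zero_iff (μ := law P x) (measurableSet_crossingPaths hA)).symm

/-- Crossing infinitely often does not depend on the first coordinate, so it passes to the state
after one step. -/
lemma ae_mem_crossingSet_of_mem (hA : MeasurableSet A) {x : X} (hx : x ∈ crossingSet P A) :
    ∀ᵐ z ∂P x, z ∈ crossingSet P A := by
  simp only [mem_crossingSet_iff hA] at hx ⊢
  refine (ae_ae_shift_of_ae P (measurableSet_crossingPaths hA)).1 ?_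
  filter_upwards [hx] with y hy using shift_mem_crossingPaths_iff.2 hy

lemma law_eq_one_iff {D : Set (ℕ → X)} (hD : MeasurableSet D) {x : X} :
    law P x D = 1 ↔ ∀ᵐ y ∂law P x, y ∈ D :=
  (prob_compl_eq_zero_iff hD).symm

lemma crossesBothWays_iff (hA : MeasurableSet A) : CrossesBothWays P A μ ↔
    (∀ᵐ x ∂μ, x ∈ A → ∀ᵐ y ∂law P x, ∃ n, y (n + 1) ∈ Aᶜ) ∧
    (∀ᵐ x ∂μ, x ∈ Aᶜ → ∀ᵐ y ∂law P x, ∃ n, y (n + 1) ∈ A) := by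
  have key : ∀ {B C : Set X}, MeasurableSet B → MeasurableSet C →
      (lawFrom P (μ.restrict B) {y | hitTime C y = ⊤} = 0 ↔
        ∀ᵐ x ∂μ, x ∈ B → ∀ᵐ y ∂law P x, ∃ n, y (n + 1) ∈ C) := by
    intro B C hB hC
    rw [← ae_restrict_iff' hB, ← ae_lawFrom_iff P _ (p := fun y => ∃ n, y (n + 1) ∈ C)
      (measurable_shift (measurableSet_exists_mem hC)), measure_eq_zero_iff_ae_notMem]
    refine eventually_congr (Eventually.of_forall fun y => ?_)
    rw [← hitTime_lt_top_iff, lt_top_iff_ne_top]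
    rfl
  exact and_congr (key hA hA.compl) (key hA.compl hA)

/-- Stationarity carries both hypotheses from time 0 to every time; thus the path reaches `Aᶜ` and
later `A`, and an entrance lies in between. -/
lemma CrossesBothWays.ae_exists_entersAt (hc : CrossesBothWays P A μ) (hinv : P.Invariant μ)
    (hA : MeasurableSet A) : ∀ᵐ x ∂μ, ∀ᵐ y ∂law P x, ∃ k, EntersAt A y k := by
  obtain ⟨h1, h2⟩ := (crossesBothWays_iff hA).1 hc
  have key : ∀ {B C : Set X}, MeasurableSet B → MeasurableSet C →
      (∀ᵐ x ∂μ, x ∈ B → ∀ᵐ y ∂law P x, ∃ n, y (n + 1) ∈ C) →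
      ∀ᵐ y ∂lawFrom P μ, ∀ k, y k ∈ B → ∃ n, y (n + 1 + k) ∈ C := by
    intro B C hB hC h
    have h0 : ∀ᵐ y ∂lawFrom P μ, y 0 ∈ B → ∃ n, y (n + 1) ∈ C := by
      refine (ae_lawFrom_iff P μ (MeasurableSet.imp (measurable_coord 0 hB)
        (measurable_shift (measurableSet_exists_mem hC)))).2 ?_
      filter_upwards [h] with x hx
      by_cases hxB : x ∈ B
      · filter_upwards [hx hxB] with y hy _ using hy
      · filter_upwards [(ae_law_zero P (p := fun x => x ∉ B) hB.compl).2 hxB] with y hy hy'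
          using (hy hy').elim
    refine ae_all_iff.2 fun k => ?_
    filter_upwards [((measurePreserving_shift P hinv).iterate k).quasiMeasurePreserving.ae h0]
      with y hy
    simpa only [iterate_shift_apply, zero_add] using hy
  refine Measure.ae_ae_of_ae_comp (μ := μ) (κ := law P) ?_
  filter_upwards [key hA hA.compl h1, key hA.compl hA h2] with y hy1 hy2
  have hAc : ∃ n, y n ∈ Aᶜ := by
    by_cases h0 : y 0 ∈ A
    · obtain ⟨n, hn⟩ := hy1 0 h0
      exact ⟨_, hn⟩
    · exact ⟨0, h0⟩
  obtain ⟨n, hn⟩ := hAc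
  obtain ⟨m, hm⟩ := hy2 n hn
  exact exists_entersAt_of_le (by omega) hn hm

variable [SigmaFinite μ]

lemma IsRecurrent.ae_law_frequently (hμ : IsRecurrent P μ) {B : Set X} (hB : MeasurableSet B) :
    ∀ᵐ x ∂μ, x ∈ B → ∀ᵐ y ∂law P x, ∃ᶠ n in atTop, y n ∈ B := by
  filter_upwards [Measure.ae_ae_of_ae_comp (hμ.ae_frequently hB)] with x hx hxB
  filter_upwards [hx, (ae_law_zero P hB).2 hxB] with y hy hy0 using hy ⟨0, hy0⟩

lemma IsRecurrent.ae_law_frequently_eq (hμ : IsRecurrent P μ) {B : Set X}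
    (hB : MeasurableSet B) : ∀ᵐ x ∂μ, ∀ᵐ z ∂P x,
      law P z {y | ∃ᶠ n in atTop, y n ∈ B} = law P x {y | ∃ᶠ n in atTop, y n ∈ B} :=
  hμ.ae_law_eq_of_shift_invariant (measurableSet_frequently_mem hB) <| by
    ext y; exact frequently_shift_iff

/-- Almost every point of `Aᶜ` from which the chain can jump to `A` belongs to the crossing set. -/
lemma IsRecurrent.ae_mem_crossingSet (hμ : IsRecurrent P μ) (hA : MeasurableSet A) :
    ∀ᵐ x ∂μ, x ∈ exitSet P Aᶜ → x ∈ crossingSet P A := by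
  filter_upwards [hμ.ae_law_frequently hA.compl, hμ.ae_law_frequently_eq hA,
    ae_ae_of_invariant hμ.1 (hμ.ae_law_frequently hA)] with x h1 h2 h3 hx
  have hPA : P x A ≠ 0 := by
    have := hx.2
    rw [compl_compl] at this
    exact this.ne'
  -- The probability of visiting `A` infinitely often is constant along the chain and is 1 from
  -- almost every point of `A`. A jump into `A` of positive probability thus forces the value 1 at
  -- `x`.
  have h4 : ∃ᵐ z ∂P x, z ∈ A := frequently_ae_mem_iff.2 hPA
  obtain ⟨z, hzA, hz2, hz3⟩ := (h4.and_eventually (h2.and h3)).exists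
  have hx1 := (law_eq_one_iff (measurableSet_frequently_mem hA)).2 (hz3 hzA)
  rw [hz2, law_eq_one_iff (measurableSet_frequently_mem hA)] at hx1
  rw [mem_crossingSet_iff hA]
  filter_upwards [hx1, h1 hx.1] with y ha hb using ⟨ha, hb⟩

/-- The probability of infinitely many visits is almost everywhere constant, and it is 1 on the
non-null set `B`. -/
lemma IsIrreducibleMeasure.ae_law_frequently (hirr : IsIrreducibleMeasure P μ)
    (hμ : IsRecurrent P μ) {B : Set X} (hB : MeasurableSet B) (h0 : μ B ≠ 0) :
    ∀ᵐ x ∂μ, ∀ᵐ y ∂law P x, ∃ᶠ n in atTop, y n ∈ B := by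
  have hm := measurableSet_frequently_mem hB
  obtain ⟨c, hc⟩ := hirr.exists_ae_eq_const ((law P).measurable_coe hm)
    (hμ.ae_law_frequently_eq hB)
  have h4 : ∃ᵐ z ∂μ, z ∈ B := frequently_ae_mem_iff.2 h0
  obtain ⟨z, hzB, hz1, hz2⟩ := (h4.and_eventually ((hμ.ae_law_frequently hB).and hc)).exists
  have hc1 : c = 1 := hz2 ▸ (law_eq_one_iff hm).2 (hz1 hzB)
  filter_upwards [hc] with x hx
  exact (law_eq_one_iff hm).1 (hx.trans hc1)

/-- A crossing of positive measure makes both `A` and `Aᶜ` non-null, the former by invariance of the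
path law under the shift; both are then visited infinitely often. -/
lemma IsIrreducibleMeasure.crossesBothWays (hirr : IsIrreducibleMeasure P μ)
    (hμ : IsRecurrent P μ) (hA : MeasurableSet A)
    (hcross : 0 < lawFrom P μ {y | y 0 ∈ Aᶜ ∧ y 1 ∈ A}) : CrossesBothWays P A μ := by
  have hnext : ∀ {B : Set X}, MeasurableSet B → μ B ≠ 0 → ∀ {C : Set X},
      ∀ᵐ x ∂μ, x ∈ C → ∀ᵐ y ∂law P x, ∃ n, y (n + 1) ∈ B := by
    intro B hB h0 C
    filter_upwards [hirr.ae_law_frequently hμ hB h0] with x hx _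
    filter_upwards [hx] with y hy
    obtain ⟨n, hn, h⟩ := frequently_atTop.1 hy 1
    exact ⟨n - 1, by rwa [Nat.sub_add_cancel hn]⟩
  have hAc : μ Aᶜ ≠ 0 := by
    intro h0
    refine hcross.ne' (measure_eq_zero_iff_ae_notMem.2 ?_)
    have : ∀ᵐ y ∂lawFrom P μ, y 0 ∉ Aᶜ := by
      refine (ae_lawFrom_iff P μ (measurable_coord 0 hA.compl.compl)).2 ?_
      filter_upwards [measure_eq_zero_iff_ae_notMem.1 h0] with x hx
      exact (ae_law_zero P (p := fun x => x ∉ Aᶜ) hA.compl.compl).2 hx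
    filter_upwards [this] with y hy h using hy h.1
  have hA0 : μ A ≠ 0 := by
    intro h0
    refine hcross.ne' (measure_eq_zero_iff_ae_notMem.2 ?_)
    have : ∀ᵐ y ∂lawFrom P μ, y 0 ∉ A := by
      refine (ae_lawFrom_iff P μ (measurable_coord 0 hA.compl)).2 ?_
      filter_upwards [measure_eq_zero_iff_ae_notMem.1 h0] with x hx
      exact (ae_law_zero P (p := fun x => x ∉ A) hA.compl).2 hx
    filter_upwards [(measurePreserving_shift P hμ.1).quasiMeasurePreserving.ae this]
      with y hy h using hy h.2
  exact (crossesBothWays_iff hA).2 ⟨hnext hA.compl hAc, hnext hA hA0⟩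

end Crossing

/-! ### The entrance and exit chains as induced chains -/

section Induced

variable {X : Type*} [MeasurableSpace X] {P : Kernel X X} {μ : Measure X} {A : Set X}

lemma kop_comapRight_subtype (κ : Kernel X X) {B : Set X} (hB : MeasurableSet B) (f : B → ℝ≥0∞)
    (x : X) : kop (κ.comapRight (MeasurableEmbedding.subtype_coe hB)) f x =
      ∫⁻ z in B, Function.extend Subtype.val f 0 z ∂κ x := by
  rw [← lintegral_subtype_comap hB]
  refine lintegral_congr fun b => ?_
  rw [Subtype.val_injective.extend_apply]

lemma bind_comapRight_subtype (κ : Kernel X X) {B : Set X} (hB : MeasurableSet B) :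
    μ.bind (κ.comapRight (MeasurableEmbedding.subtype_coe hB)) =
      (μ.bind κ).comap Subtype.val := by
  ext t ht
  rw [Measure.bind_apply ht (Kernel.aemeasurable _), comap_subtype_coe_apply hB,
    Measure.bind_apply (hB.subtype_image ht) (Kernel.aemeasurable _)]
  exact lintegral_congr fun x => Kernel.comapRight_apply' _ _ _ ht

lemma sigmaFinite_comap_subtype (ν : Measure X) [SigmaFinite ν] {B : Set X}
    (hB : MeasurableSet B) : SigmaFinite (ν.comap (Subtype.val : B → X)) := by
  refine SigmaFinite.of_map _ measurable_subtype_coe.aemeasurable ?_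
  rw [map_comap_subtype_coe hB]
  infer_instance

lemma measurable_extend_subtype {B : Set X} (hB : MeasurableSet B) {f : B → ℝ≥0∞}
    (hf : Measurable f) : Measurable (Function.extend Subtype.val f 0) :=
  (MeasurableEmbedding.subtype_coe hB).measurable_extend hf measurable_zero

lemma extend_of_mem {X : Type*} {B : Set X} (f : B → ℝ≥0∞) {x : X} (hx : x ∈ B) :
    Function.extend Subtype.val f 0 x = f ⟨x, hx⟩ :=
  Subtype.val_injective.extend_apply f 0 ⟨x, hx⟩

/-- The jumps from `Aᶜ` to `A`, as a kernel with values in `A`. -/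
def entranceMark (P : Kernel X X) (hA : MeasurableSet A) : Kernel X A :=
  (enterKernel P hA).comapRight (MeasurableEmbedding.subtype_coe hA)

/-- The kernel that stays in place with the probability of jumping from `Aᶜ` to `A`. -/
def holdKernel (P : Kernel X X) (hA : MeasurableSet A) : Kernel X X where
  toFun x := enterKernel P hA x Set.univ • Measure.dirac x
  measurable' := Measure.measurable_of_measurable_coe _ fun s hs => by
    have hm : Measurable fun x => enterKernel P hA x Set.univ * s.indicator 1 x :=
      ((enterKernel P hA).measurable_coe .univ).mul (measurable_one.indicator hs)
    have e : (fun x => (enterKernel P hA x Set.univ • Measure.dirac x) s) =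
        fun x => enterKernel P hA x Set.univ * s.indicator 1 x := funext fun x => by
      rw [Measure.smul_apply, Measure.dirac_apply' x hs, smul_eq_mul]
    rwa [e]

/-- The positions of the jumps from `Aᶜ` to `A` before the jump, as a kernel with values in `Aᶜ`. -/
def exitMark (P : Kernel X X) (hA : MeasurableSet A) : Kernel X (Aᶜ : Set X) :=
  (holdKernel P hA).comapRight (MeasurableEmbedding.subtype_coe hA.compl)

/-- The transition from `Aᶜ` conditioned on jumping to `A`. -/
def condKernel (P : Kernel X X) (hA : MeasurableSet A) : Kernel (Aᶜ : Set X) X where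
  toFun x := ProbabilityTheory.cond (P x) A
  measurable' := Measure.measurable_of_measurable_coe _ fun s hs => by
    have hm : Measurable fun x : X => (P x A)⁻¹ * P x (A ∩ s) :=
      (P.measurable_coe hA).inv.mul (P.measurable_coe (hA.inter hs))
    simp only [ProbabilityTheory.cond_apply hA]
    exact hm.comp measurable_subtype_coe

lemma lintegral_indicator_entered [IsMarkovKernel P] {x : X}
    (hx : ∀ᵐ y ∂law P x, ∃ k, EntersAt A y k)
    (R : (ℕ → X) → ℝ≥0∞) :
    ∫⁻ y, {y | ∃ k, EntersAt A y k}.indicator R y ∂law P x = ∫⁻ y, R y ∂law P x := by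
  refine lintegral_congr_ae ?_
  filter_upwards [hx] with y hy using Set.indicator_of_mem (by exact hy) R

variable (hA : MeasurableSet A)

lemma enterKernel_univ_of_notMem {x : X} (hx : x ∉ A) : enterKernel P hA x Set.univ = P x A := by
  rw [enterKernel_of_notMem P hA hx, Measure.restrict_apply_univ]

lemma enterKernel_univ_of_mem {x : X} (hx : x ∈ A) : enterKernel P hA x Set.univ = 0 := by
  rw [enterKernel_of_mem P hA hx, Measure.coe_zero, Pi.zero_apply]

lemma kop_entranceMark (f : A → ℝ≥0∞) (x : X) :
    kop (entranceMark P hA) f x = kop (enterKernel P hA) (Function.extend Subtype.val f 0) x := by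
  rw [entranceMark, kop_comapRight_subtype _ hA, enterKernel_restrict, kop]

lemma kop_exitMark {f : (Aᶜ : Set X) → ℝ≥0∞} (hf : Measurable f) (x : X) :
    kop (exitMark P hA) f x =
      enterKernel P hA x Set.univ * Function.extend Subtype.val f 0 x := by
  have hm := measurable_extend_subtype hA.compl hf
  rw [exitMark, kop_comapRight_subtype _ hA.compl, ← lintegral_indicator hA.compl]
  change ∫⁻ z, _ ∂(enterKernel P hA x Set.univ • Measure.dirac x) = _
  rw [lintegral_smul_measure, lintegral_dirac' _ (hm.indicator hA.compl), smul_eq_mul]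
  by_cases hx : x ∈ A
  · simp [enterKernel_univ_of_mem hA hx]
  · rw [Set.indicator_of_mem (by exact hx)]

lemma condKernel_of_notMem_exitSet {a : (Aᶜ : Set X)} (ha : (a : X) ∉ exitSet P Aᶜ) :
    condKernel P hA a = 0 := by
  have h0 : P a A = 0 := by
    by_contra hne
    exact ha ⟨a.2, by rw [compl_compl]; exact pos_iff_ne_zero.2 hne⟩
  exact ProbabilityTheory.cond_eq_zero_of_meas_eq_zero h0

lemma bind_entranceMark [IsMarkovKernel P] :
    μ.bind (entranceMark P hA) = entranceMeasure P A μ := by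
  rw [entranceMark, bind_comapRight_subtype _ hA, bind_enterKernel, entranceMeasure]
  ext t ht
  rw [comap_subtype_coe_apply hA, comap_subtype_coe_apply hA,
    Measure.restrict_eq_self _ (Subtype.coe_image_subset A t)]

lemma bind_exitMark [IsMarkovKernel P] : μ.bind (exitMark P hA) = exitMeasure P A μ := by
  rw [exitMark, bind_comapRight_subtype _ hA.compl, exitMeasure]
  ext t ht
  have hm := hA.compl.subtype_image ht
  rw [comap_subtype_coe_apply hA.compl, comap_subtype_coe_apply hA.compl,
    Measure.bind_apply hm (Kernel.aemeasurable _), withDensity_apply _ hm,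
    ← lintegral_indicator hm]
  refine lintegral_congr fun x => ?_
  change (enterKernel P hA x Set.univ • Measure.dirac x) _ = _
  rw [Measure.smul_apply, Measure.dirac_apply' x hm, smul_eq_mul]
  by_cases hx : x ∈ Subtype.val '' t
  · have hxA : x ∉ A := Subtype.coe_image_subset Aᶜ t hx
    rw [Set.indicator_of_mem hx, Set.indicator_of_mem hx, enterKernel_univ_of_notMem hA hxA,
      Pi.one_apply, mul_one]
  · rw [Set.indicator_of_notMem hx, Set.indicator_of_notMem hx, mul_zero]

/-- Before restriction to `A`, the measure is dominated by `μ.bind P = μ`. -/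
lemma sigmaFinite_entranceMeasure (hA : MeasurableSet A) [SigmaFinite μ] (hinv : P.Invariant μ) :
    SigmaFinite (entranceMeasure P A μ) := by
  have hle : (μ.restrict Aᶜ).bind P ≤ μ := by
    refine Measure.le_iff.2 fun B hB => ?_
    conv_rhs => rw [← hinv.def]
    rw [Measure.bind_apply hB P.aemeasurable, Measure.bind_apply hB P.aemeasurable]
    exact lintegral_mono' Measure.restrict_le_self le_rfl
  have := Measure.sigmaFinite_of_le μ hle
  exact sigmaFinite_comap_subtype _ hA

variable [IsMarkovKernel P]

/-- The measure collects jumps that start in the exit set, almost every point of which is in the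
crossing set; that set is kept by one step of the chain. -/
lemma isProperEntrance (hA : MeasurableSet A) [SigmaFinite μ] (hμ : IsRecurrent P μ) :
    IsProperEntrance P (entranceMeasure P A μ) := by
  refine measure_eq_zero_iff_ae_notMem.2 ?_
  simp only [Set.mem_ofPred_eq, not_not]
  refine (ae_restrict_iff_subtype hA (p := fun x => x ∈ crossingSet P A)).1 ?_
  rw [← bind_enterKernel P hA]
  refine Measure.ae_comp_of_ae_ae (measurableSet_crossingSet hA) ?_
  filter_upwards [hμ.ae_mem_crossingSet hA] with x hx
  by_cases hxe : x ∈ exitSet P Aᶜ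
  · rw [enterKernel_of_notMem P hA hxe.1]
    exact ae_restrict_of_ae (ae_mem_crossingSet_of_mem hA (hx hxe))
  · by_cases hxA : x ∈ A
    · simp [enterKernel_of_mem P hA hxA]
    · have h0 : P x A = 0 := by
        by_contra hne
        exact hxe ⟨hxA, by rw [compl_compl]; exact pos_iff_ne_zero.2 hne⟩
      rw [enterKernel_of_notMem P hA hxA, Measure.restrict_eq_zero.2 h0]
      simp

/-- The density `P x A` is positive exactly where the chain can leave `Aᶜ`. -/
lemma isProperExit (hA : MeasurableSet A) [SigmaFinite μ] (hμ : IsRecurrent P μ) :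
    IsProperExit P (exitMeasure P A μ) := by
  refine measure_eq_zero_iff_ae_notMem.2 ?_
  simp only [Set.mem_ofPred_eq, not_not]
  refine (ae_restrict_iff_subtype hA.compl
    (p := fun x => x ∈ exitSet P Aᶜ ∩ crossingSet P A)).1 ?_
  rw [ae_restrict_iff' hA.compl, ae_withDensity_iff (P.measurable_coe hA)]
  filter_upwards [hμ.ae_mem_crossingSet hA] with x hx hPx hxA
  have hxe : x ∈ exitSet P Aᶜ := ⟨hxA, by rw [compl_compl]; exact pos_iff_ne_zero.2 hPx⟩
  exact ⟨hxe, hx hxe⟩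

lemma sigmaFinite_exitMeasure (hA : MeasurableSet A) [SigmaFinite μ] : SigmaFinite (exitMeasure P A μ) := by
  have : SigmaFinite (μ.withDensity fun x => P x A) :=
    SigmaFinite.withDensity_of_ne_top (ae_of_all _ fun x => measure_ne_top _ _)
  exact sigmaFinite_comap_subtype _ hA.compl

lemma lintegral_entrancePos {f : Option A → ℝ≥0∞} (hf : Measurable f) (x : X) :
    ∫⁻ y, {y | ∃ k, EntersAt A y k}.indicator (f ∘ entrancePos A) y ∂law P x =
      green (stayKernel P hA) (kop (entranceMark P hA) (f ∘ some)) x := by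
  have hfs : Measurable (f ∘ some : A → ℝ≥0∞) := hf.comp measurable_some
  have hm : Measurable (kop (entranceMark P hA) (f ∘ some)) := measurable_kop _ hfs
  have hφ : kop (entranceMark P hA) (f ∘ some) = fun x =>
      kop (enterKernel P hA) (Function.extend Subtype.val (f ∘ some) 0) x :=
    funext fun x => kop_entranceMark hA _ x
  rw [hφ] at hm ⊢
  refine lintegral_law_entrance P hA (hf.comp (measurable_entrancePos hA))
    (r := fun _ => Function.extend Subtype.val (f ∘ some) 0)
    (fun _ => measurable_extend_subtype hA hfs) (fun x y => ?_) hm x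
  by_cases hC : x ∈ Aᶜ ∧ y 0 ∈ A
  · rw [if_pos hC, Function.comp_apply, (pos_prepend_of_crossing hC.1 hC.2).1,
      extend_of_mem _ hC.2]
    rfl
  · rw [if_neg hC, Function.comp_apply, (pos_prepend_of_not_crossing hC).1, Function.comp_apply]

/-- At the entrance the functional reads the state before the jump, so the jump contributes only its
probability, which is the mass of `exitMark`. -/
lemma lintegral_exitPos {f : Option (Aᶜ : Set X) → ℝ≥0∞} (hf : Measurable f) (x : X) :
    ∫⁻ y, {y | ∃ k, EntersAt A y k}.indicator (f ∘ exitPos A) y ∂law P x =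
      green (stayKernel P hA) (kop (exitMark P hA) (f ∘ some)) x := by
  have hfs : Measurable (f ∘ some : (Aᶜ : Set X) → ℝ≥0∞) := hf.comp measurable_some
  have hm : Measurable (kop (exitMark P hA) (f ∘ some)) := measurable_kop _ hfs
  have hφ : kop (exitMark P hA) (f ∘ some) = fun x =>
      kop (enterKernel P hA) (fun _ => Function.extend Subtype.val (f ∘ some) 0 x) x :=
    funext fun x => by rw [kop_exitMark hA hfs, kop, lintegral_const, mul_comm]
  rw [hφ] at hm ⊢
  refine lintegral_law_entrance P hA (hf.comp (measurable_exitPos hA))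
    (r := fun x _ => Function.extend Subtype.val (f ∘ some) 0 x)
    (fun _ => measurable_const) (fun x y => ?_) hm x
  by_cases hC : x ∈ Aᶜ ∧ y 0 ∈ A
  · rw [if_pos hC, Function.comp_apply, (pos_prepend_of_crossing hC.1 hC.2).2,
      extend_of_mem _ hC.1]
    rfl
  · rw [if_neg hC, Function.comp_apply, (pos_prepend_of_not_crossing hC).2, Function.comp_apply]

lemma ae_exists_entersAt_of_mem_crossingSet (hA : MeasurableSet A) {x : X} (hx : x ∈ crossingSet P A) :
    ∀ᵐ y ∂law P x, ∃ k, EntersAt A y k := by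
  filter_upwards [(mem_crossingSet_iff hA).1 hx] with y hy
  exact exists_entersAt_of_mem_crossingPaths hy

lemma kop_entranceKernel {f : Option A → ℝ≥0∞} (hf : Measurable f) (a : A) :
    kop (entranceKernel P hA) f (some a) = ∫⁻ y, f (entrancePos A y) ∂law P (a : X) := by
  change ∫⁻ o, f o ∂((law P).map (entrancePos A)) (a : X) = _
  rw [Kernel.map_apply _ (measurable_entrancePos hA), lintegral_map hf (measurable_entrancePos hA)]

lemma kop_exitKernel {f : Option (Aᶜ : Set X) → ℝ≥0∞} (hf : Measurable f) {a : (Aᶜ : Set X)}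
    (ha : (a : X) ∈ exitSet P Aᶜ) : kop (exitKernel P hA) f (some a) =
      kop (condKernel P hA) (fun z => ∫⁻ y, f (exitPos A y) ∂law P z) a := by
  change ∫⁻ o, f o ∂exitStep P A (a : X) = _
  rw [exitStep, if_pos ha, Measure.lintegral_bind (Kernel.aemeasurable _) hf.aemeasurable]
  refine lintegral_congr fun z => ?_
  rw [Kernel.map_apply _ (measurable_exitPos hA), lintegral_map hf (measurable_exitPos hA)]

/-- The entrance chain is induced. -/
lemma isInduced_entrance [SigmaFinite μ] (hμ : IsRecurrent P μ) :
    IsInduced P (stayKernel P hA) (enterKernel P hA) (entranceMark P hA)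
      (Kernel.deterministic Subtype.val measurable_subtype_coe) (entranceKernel P hA) μ := by
  have hΨ : ∀ (g : X → ℝ≥0∞), Measurable g → ∀ a : A,
      kop (Kernel.deterministic Subtype.val measurable_subtype_coe) g a = g a := fun g hg a =>
    Kernel.lintegral_deterministic' _ hg
  have hgm : ∀ f : Option A → ℝ≥0∞, Measurable f →
      Measurable (green (stayKernel P hA) (kop (entranceMark P hA) (f ∘ some))) := fun f hf =>
    measurable_green (measurable_kop _ (hf.comp measurable_some))
  refine ⟨stayKernel_add_enterKernel P hA, ?_, fun x => ?_, fun a f hf => ?_, ?_, ?_⟩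
  · ext x t ht
    rw [Kernel.deterministic_comp_eq_map, Kernel.map_apply' _ measurable_subtype_coe _ ht,
      entranceMark, Kernel.comapRight_apply, ← Measure.map_apply measurable_subtype_coe ht,
      map_comap_subtype_coe hA, enterKernel_restrict]
  · rw [entranceMark, Kernel.comapRight_apply, comap_subtype_coe_apply hA, Set.image_univ,
      Subtype.range_coe, ← Measure.restrict_apply_univ, enterKernel_restrict]
  · rw [hΨ _ (hgm f hf), ← lintegral_entrancePos hA hf, kop_entranceKernel hA hf]
    exact lintegral_mono fun y => Set.indicator_le_self' (fun _ _ => zero_le) y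
  · rw [bind_entranceMark]
    filter_upwards [measure_eq_zero_iff_ae_notMem.1 (isProperEntrance hA hμ)] with a ha f hf
    rw [hΨ _ (hgm f hf), ← lintegral_entrancePos hA hf, kop_entranceKernel hA hf,
      lintegral_indicator_entered (ae_exists_entersAt_of_mem_crossingSet hA (not_not.1 ha))]
    rfl
  · exact ae_of_all _ fun a => measure_univ

/-- The exit chain is induced. -/
lemma isInduced_exit [SigmaFinite μ] (hμ : IsRecurrent P μ) :
    IsInduced P (stayKernel P hA) (enterKernel P hA) (exitMark P hA)
      (condKernel P hA) (exitKernel P hA) μ := by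
  have hproper := measure_eq_zero_iff_ae_notMem.1 (isProperExit hA hμ)
  refine ⟨stayKernel_add_enterKernel P hA, ?_, fun x => ?_, fun a f hf => ?_, ?_, ?_⟩
  · ext x t ht
    rw [Kernel.comp_apply' _ _ _ ht]
    change kop (exitMark P hA) (fun a => condKernel P hA a t) x = _
    rw [kop_exitMark hA ((condKernel P hA).measurable_coe ht)]
    by_cases hx : x ∈ A
    · rw [enterKernel_univ_of_mem hA hx, zero_mul, enterKernel_of_mem P hA hx]; rfl
    · rw [enterKernel_univ_of_notMem hA hx, extend_of_mem _ (by exact hx),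
        enterKernel_of_notMem P hA hx, Measure.restrict_apply ht]
      change P x A * ProbabilityTheory.cond (P x) A t = _
      rw [mul_comm, Set.inter_comm]
      exact ProbabilityTheory.cond_mul_eq_inter' hA (measure_ne_top _ _) t
  · rw [← kop_one, kop_exitMark hA measurable_const]
    by_cases hx : x ∈ A
    · rw [enterKernel_univ_of_mem hA hx, zero_mul]
    · rw [extend_of_mem _ (by exact hx), mul_one]
  · by_cases ha : (a : X) ∈ exitSet P Aᶜ
    · rw [kop_exitKernel hA hf ha]
      refine kop_mono _ (fun z => ?_) a
      rw [← lintegral_exitPos hA hf]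
      exact lintegral_mono fun y => Set.indicator_le_self' (fun _ _ => zero_le) y
    -- Conditioning on a null event gives the zero measure here, while the exit chain moves to `†`;
    -- only the inequality holds.
    · rw [kop, condKernel_of_notMem_exitSet hA ha, lintegral_zero_measure]
      exact zero_le
  · rw [bind_exitMark]
    filter_upwards [hproper] with a ha f hf
    obtain ⟨hae, hac⟩ := not_not.1 ha
    rw [kop_exitKernel hA hf hae]
    refine kop_congr_ae ?_
    have hz : ∀ᵐ z ∂condKernel P hA a, z ∈ crossingSet P A :=
      (ProbabilityTheory.cond_absolutelyContinuous (μ := P a) (s := A)).ae_le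
        (ae_mem_crossingSet_of_mem hA hac)
    filter_upwards [hz] with z hz
    rw [← lintegral_exitPos hA hf,
      lintegral_indicator_entered (ae_exists_entersAt_of_mem_crossingSet hA hz)]
    rfl
  · rw [bind_exitMark]
    filter_upwards [hproper] with a ha
    have h0 : P a A ≠ 0 := by
      have := (not_not.1 ha).1.2
      rw [compl_compl] at this
      exact this.ne'
    have := ProbabilityTheory.cond_isProbabilityMeasure h0
    exact measure_univ (μ := ProbabilityTheory.cond (P a) A)

lemma lintegral_visits_before_entrance {B : Set X} (hB : MeasurableSet B) (x : X) :
    ∫⁻ y, ∑' k : {k : ℕ // (k : ℕ∞) < entranceTime A y}, B.indicator 1 (y k) ∂law P x =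
      green (stayKernel P hA) (B.indicator 1) x := by
  classical
  have hone : Measurable (B.indicator (1 : X → ℝ≥0∞)) := measurable_one.indicator hB
  have e : ∀ y : ℕ → X, ∑' k : {k : ℕ // (k : ℕ∞) < entranceTime A y}, B.indicator 1 (y k) =
      ∑' k, if ∀ j ≤ k, ¬ EntersAt A y j then B.indicator (1 : X → ℝ≥0∞) (y k) else 0 := by
    intro y
    refine (tsum_subtype {k : ℕ | (k : ℕ∞) < entranceTime A y}
      (fun k => B.indicator (1 : X → ℝ≥0∞) (y k))).trans (tsum_congr fun k => ?_)
    rw [Set.indicator_apply]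
    exact if_congr lt_entranceTime_iff rfl rfl
  have hmeas : ∀ k, MeasurableSet {y : ℕ → X | ∀ j ≤ k, ¬ EntersAt A y j} := fun k => by
    simp only [Set.ofPred_forall]
    exact MeasurableSet.iInter fun j => MeasurableSet.iInter fun _ =>
      (measurableSet_entersAt hA j).compl
  simp only [e]
  rw [lintegral_tsum (f := fun k (y : ℕ → X) => if ∀ j ≤ k, ¬ EntersAt A y j then
    B.indicator (1 : X → ℝ≥0∞) (y k) else 0) fun k => (Measurable.ite (hmeas k)
    (hone.comp (measurable_coord k)) measurable_const).aemeasurable]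
  refine tsum_congr fun k => ?_
  rw [← lintegral_law_before_entrance P hA hone k x]

/-- The potential of the full mark is the probability that an entrance ever occurs, here 1 almost
everywhere, and the potential of `1_B` is the expected number of visits to `B` before the entrance.
-/
lemma CrossesBothWays.kacFormula (hA : MeasurableSet A) [SigmaFinite μ] (hμ : IsRecurrent P μ)
    (hc : CrossesBothWays P A μ) : KacFormula P A μ := by
  intro B hB
  have hI := isInduced_entrance hA hμ
  have hsf : SigmaFinite (μ.bind (entranceMark P hA)) := by
    rw [bind_entranceMark]; exact sigmaFinite_entranceMeasure hA hμ.1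
  have hone : ∀ᵐ x ∂μ, green (stayKernel P hA) (fun x => entranceMark P hA x Set.univ) x = 1 := by
    filter_upwards [hc.ae_exists_entersAt hμ.1 hA] with x hx
    have h1 := lintegral_entrancePos (P := P) hA (f := fun _ => 1) measurable_const x
    rw [lintegral_indicator_entered hx] at h1
    simp only [Function.comp_def, lintegral_const, measure_univ, mul_one] at h1
    rw [h1]
    congr 1
    funext x
    exact (kop_one _ x).symm
  have hm : Measurable (green (stayKernel P hA) (B.indicator 1)) :=
    measurable_green (measurable_one.indicator hB)
  rw [← hI.lintegral_kop_green_indicator hμ hone hB, ← hI.lintegral_kop_entry hm, bind_entranceMark]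
  refine lintegral_congr fun a => ?_
  rw [lintegral_visits_before_entrance hA hB]
  exact Kernel.lintegral_deterministic' _ hm

end Induced

end MarkovInducing

end

/-! ### The theorem -/

open MarkovInducing
theorem theorem3p1 {X : Type*} [MeasurableSpace X] (P : Kernel X X) [IsMarkovKernel P]
    (μ : Measure X) [SigmaFinite μ] (hμ : IsRecurrent P μ)
    (A : Set X) (hA : MeasurableSet A)
    (hcross : 0 < lawFrom P μ {y | y 0 ∈ Aᶜ ∧ y 1 ∈ A}) :
    (IsProperEntrance P (entranceMeasure P A μ) ∧
      (entranceKernel P hA).Invariant (extendMeasure (entranceMeasure P A μ)) ∧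
      IsRecurrent (entranceKernel P hA) (extendMeasure (entranceMeasure P A μ))) ∧
    (IsProperExit P (exitMeasure P A μ) ∧
      (exitKernel P hA).Invariant (extendMeasure (exitMeasure P A μ)) ∧
      IsRecurrent (exitKernel P hA) (extendMeasure (exitMeasure P A μ))) ∧
    (IsIrreducibleMeasure P μ →
      IsErgodic (entranceKernel P hA) (extendMeasure (entranceMeasure P A μ)) ∧
      IsErgodic (exitKernel P hA) (extendMeasure (exitMeasure P A μ)) ∧
      KacFormula P A μ) ∧
    (CrossesBothWays P A μ → KacFormula P A μ) := by
  have hIn := isInduced_entrance hA hμ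
  have hEx := isInduced_exit hA hμ
  have hsIn : SigmaFinite (entranceMeasure P A μ) := sigmaFinite_entranceMeasure hA hμ.1
  have hsEx : SigmaFinite (exitMeasure P A μ) := sigmaFinite_exitMeasure hA
  have hsIn' : SigmaFinite (extendMeasure (entranceMeasure P A μ)) :=
    measurableEmbedding_some.sigmaFinite_map
  have hsEx' : SigmaFinite (extendMeasure (exitMeasure P A μ)) :=
    measurableEmbedding_some.sigmaFinite_map
  -- The results on induced chains concern `μ.bind Φ`, so the entrance and exit measures are
  -- rewritten in that form.
  have hrIn : IsRecurrent (entranceKernel P hA) (extendMeasure (entranceMeasure P A μ)) := by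
    rw [← bind_entranceMark hA] at hsIn ⊢
    exact hIn.isRecurrent hμ
  have hrEx : IsRecurrent (exitKernel P hA) (extendMeasure (exitMeasure P A μ)) := by
    rw [← bind_exitMark hA] at hsEx ⊢
    exact hEx.isRecurrent hμ
  refine ⟨⟨isProperEntrance hA hμ, hrIn.1, hrIn⟩, ⟨isProperExit hA hμ, hrEx.1, hrEx⟩,
    fun hirr => ⟨?_, ?_, (hirr.crossesBothWays hμ hA hcross).kacFormula hA hμ⟩,
    fun hc => hc.kacFormula hA hμ⟩
  · have h := hrIn.1
    rw [← bind_entranceMark hA] at h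
    have := hIn.isIrreducibleMeasure hμ hirr h
    rw [bind_entranceMark] at this
    exact this.isErgodic hrIn
  · have h := hrEx.1
    rw [← bind_exitMark hA] at h
    have := hEx.isIrreducibleMeasure hμ hirr h
    rw [bind_exitMark] at this
    exact this.isErgodic hrEx
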